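/- Let $n,N,d$ be the numbers of users and arms and the dimension, let $T\ge 1$, and let $\mathcal G$ be a simple undirected graph on $\{1,\dots,n\}$ with random-walk Laplacian $l_{jj}=1$, $l_{jk}=-1/\deg(j)$ if $\{j,k\}$ is an edge, and $l_{jk}=0$ otherwise. In each round $t=1,\dots,T$ a user $j_t$ and contexts $b_1(t),\dots,b_N(t)\in\mathbb R^d$ are revealed, the learner pulls an arm $a(t)$, and the reward $r_{a(t),j_t}(t)$ is observed, where $$r_{i,j}(t)=\nu_j(t)+b_i(t)^T\mu_j+\eta_{i,j}(t).$$ Let $\mathcal F_{t-1}$ be the $\sigma$-algebra generated by $j_t$, the $b_i(t)$, and, for $\tau\le t-1$, by $j_\tau$, the $b_i(\tau)$, $a(\tau)$ and $r_{a(\tau),j_\tau}(\tau)$. Assume, for all $i,j,t$: - $|\nu_j(t)|\le 1$, $\|b_i(t)\|\le 1$, $\|\mu_j\|\le 1$ (Euclidean norm), the $\mu_j\in\mathbb R^d$ are fixed, and the baseline $\nu_j(t)$ is arbitrary but $\mathcal F_{t-1}$-measurable (for example, any deterministic sequence); - $\mathbb E(\eta_{i,j}(t)\mid\mathcal F_{t-1})=0$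 and, for a constant $R\ge 0$, $\mathbb E[\exp\{c\,\eta_{i,j}(t)\}\mid\mathcal F_{t-1}]\le\exp(c^2R^2/2)$ for every $c\in\mathbb R$; - the arm $a(t)$ is chosen by an arbitrary, possibly randomized, rule from the information $\mathcal F_{t-1}$; that is, given $\mathcal F_{t-1}$, $a(t)$ is independent of each error $\eta_{i,j}(t)$. Let $\bar b(t)=\mathbb E(b_{a(t)}(t)\mid\mathcal F_{t-1})$, $X_t=b_{a(t)}(t)-\bar b(t)$, $b_i^c(t)=b_i(t)-\bar b(t)$, $\mathcal T_{k,t}=\{1\le\tau\le t: j_\tau=k\}$, $\Delta_j=\sum_{k=1}^n l_{jk}\mu_k$ and $\|x\|_A=\sqrt{x^TAx}$. For $\lambda>0$ let $$B_k(t)=\sum_{\tau\in\mathcal T_{k,t-1}}X_\tau X_\tau^T+\sum_{\tau\in\mathcal T_{k,t-1}}\mathbb E(X_\tau X_\tau^T\mid\mathcal F_{\tau-1})+\lambda l_{kk}I_d,\qquad \bar\mu_k(t)=B_k(t)^{-1}\sum_{\tau\in\mathcal T_{k,t-1}}2X_\tau r_{a(\tau),k}(\tau),$$ $$\hat\mu_j(t)=\bar\mu_j(t)-\lambda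 B_j(t)^{-1}\sum_{k\ne j}l_{jk}\bar\mu_k(t),\qquad \Gamma_j(t)=B_j(t)+\lambda^2\sum_{k\ne j}l_{jk}^2B_k(t)^{-1}.$$ Then for all $\delta\in(0,1)$ and $1\le t\le T$, with probability at least $1-\delta/t^2$, the inequality $$|b_i^c(t)^T(\hat\mu_{j_t}(t)-\mu_{j_t})|\le\|b_i^c(t)\|_{\Gamma_{j_t}(t)^{-1}}\,\alpha(t)$$ holds simultaneously for all arms $i=1,\dots,N$, where $$\alpha(t)=(4R+12)\sqrt{2d\log\Big\{\frac{24t^4}{\delta}\Big(1+\frac1\lambda\Big)\Big\}}+\sqrt{2\lambda}\,(1+\|\Delta_{j_t}\|).$$ -/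

import Mathlib

open MeasureTheory ProbabilityTheory
open scoped Matrix

noncomputable section

/-- The vector `A x`, for a matrix `A` and a Euclidean vector `x`. -/
def matVec {d : ℕ} (A : Matrix (Fin d) (Fin d) ℝ) (x : EuclideanSpace ℝ (Fin d)) :
    EuclideanSpace ℝ (Fin d) :=
  WithLp.toLp 2 (A *ᵥ WithLp.ofLp x)

/-- The weighted norm `‖x‖_A = √(xᵀ A x)`. -/
def weightedNorm {d : ℕ} (A : Matrix (Fin d) (Fin d) ℝ) (x : EuclideanSpace ℝ (Fin d)) : ℝ :=
  Real.sqrt (inner ℝ x (matVec A x))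

open Classical in
/-- The random-walk normalized Laplacian of a simple graph on `{1, …, n}`. -/
def rwLaplacian {n : ℕ} (G : SimpleGraph (Fin n)) (j k : Fin n) : ℝ :=
  if j = k then 1 else if G.Adj j k then -1 / (G.degree j : ℝ) else 0

/-- The data of a contextual bandit with `n` users joined by a graph, `N` arms and contexts in
`ℝ^d`, over a sample space `Ω`. Rounds are numbered `1, 2, …`; values at index `0` are unused. -/
structure GraphBandit (Ω : Type*) (d N n : ℕ) where
  /-- the user graph -/
  graph : SimpleGraph (Fin n)
  /-- the user parameters `μ_j` -/
  μ : Fin n → EuclideanSpace ℝ (Fin d)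
  /-- the contexts `b_i(t)` -/
  b : Fin N → ℕ → Ω → EuclideanSpace ℝ (Fin d)
  /-- the baseline rewards `ν_j(t)` -/
  ν : Fin n → ℕ → Ω → ℝ
  /-- the errors `η_{i,j}(t)` -/
  η : Fin N → Fin n → ℕ → Ω → ℝ
  /-- the user `j_t` served in round `t` -/
  user : ℕ → Ω → Fin n
  /-- the arm `a(t)` pulled in round `t` -/
  arm : ℕ → Ω → Fin N

namespace GraphBandit

variable {Ω : Type*} {d N n : ℕ}

/-- The reward `r_{i,j}(t) = ν_j(t) + b_i(t)ᵀ μ_j + η_{i,j}(t)`. -/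
def reward (M : GraphBandit Ω d N n) (i : Fin N) (j : Fin n) (t : ℕ) (ω : Ω) : ℝ :=
  M.ν j t ω + inner ℝ (M.b i t ω) (M.μ j) + M.η i j t ω

/-- The observed reward `r_{a(t), j_t}(t)`. -/
def obsReward (M : GraphBandit Ω d N n) (t : ℕ) (ω : Ω) : ℝ :=
  M.reward (M.arm t ω) (M.user t ω) t ω

/-- The context `b_{a(t)}(t)` of the pulled arm. -/
def armContext (M : GraphBandit Ω d N n) (t : ℕ) (ω : Ω) : EuclideanSpace ℝ (Fin d) :=
  M.b (M.arm t ω) t ω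

/-- What is shown to the learner at the beginning of round `t`: the σ-algebra generated by
`j_t` and the contexts `b_i(t)`. -/
def shown (M : GraphBandit Ω d N n) (t : ℕ) : MeasurableSpace Ω :=
  MeasurableSpace.comap (M.user t) inferInstance ⊔
    ⨆ i : Fin N, MeasurableSpace.comap (M.b i t) inferInstance

/-- The information `𝓕_{t-1}` available to the learner just before the choice of `a(t)`: the
σ-algebra generated by `j_t`, the `b_i(t)`, and, for `1 ≤ τ ≤ t - 1`, by `j_τ`, the `b_i(τ)`,
`a(τ)` and `r_{a(τ), j_τ}(τ)`. -/
def history (M : GraphBandit Ω d N n) (t : ℕ) : MeasurableSpace Ω :=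
  M.shown t ⊔
    ⨆ τ ∈ Finset.Ico 1 t,
      (M.shown τ ⊔ MeasurableSpace.comap (M.arm τ) inferInstance ⊔
        MeasurableSpace.comap (M.obsReward τ) inferInstance)

/-- `Δ_j = ∑_k l_{jk} μ_k`. -/
def Delta (M : GraphBandit Ω d N n) (j : Fin n) : EuclideanSpace ℝ (Fin d) :=
  ∑ k, rwLaplacian M.graph j k • M.μ k

/-- The set `𝒯_{k,t}` of the rounds `1 ≤ τ ≤ t` in which user `k` is served. -/
def served (M : GraphBandit Ω d N n) (k : Fin n) (t : ℕ) (ω : Ω) : Finset ℕ :=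
  (Finset.Icc 1 t).filter (fun τ => M.user τ ω = k)

section Model

variable {mΩ : MeasurableSpace Ω}

/-- The semi-parametric reward model in rounds `1, …, T`, with `R`-sub-Gaussian errors. -/
structure IsSemiparametric (M : GraphBandit Ω d N n) (P : Measure Ω) (R : ℝ) (T : ℕ) : Prop where
  measurable_user : ∀ t ∈ Finset.Icc 1 T, Measurable (M.user t)
  measurable_arm : ∀ t ∈ Finset.Icc 1 T, Measurable (M.arm t)
  measurable_b : ∀ i, ∀ t ∈ Finset.Icc 1 T, Measurable (M.b i t)
  measurable_η : ∀ i j, ∀ t ∈ Finset.Icc 1 T, Measurable (M.η i j t)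
  /-- The baseline is arbitrary, but is settled before the arm is drawn. -/
  measurable_ν : ∀ j, ∀ t ∈ Finset.Icc 1 T, Measurable[M.history t] (M.ν j t)
  norm_μ_le : ∀ j, ‖M.μ j‖ ≤ 1
  norm_b_le : ∀ i, ∀ t ∈ Finset.Icc 1 T, ∀ ω, ‖M.b i t ω‖ ≤ 1
  abs_ν_le : ∀ j, ∀ t ∈ Finset.Icc 1 T, ∀ ω, |M.ν j t ω| ≤ 1
  /-- `𝔼(η_{i,j}(t) | 𝓕_{t-1}) = 0`. -/
  condExp_η : ∀ i j, ∀ t ∈ Finset.Icc 1 T, P[M.η i j t | M.history t] =ᵐ[P] 0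
  /-- `𝔼(exp(c η_{i,j}(t)) | 𝓕_{t-1}) ≤ exp(c² R² / 2)`. Integrability is stated because the
  conditional expectation of a non-integrable function is `0` by convention. -/
  subGaussian_η : ∀ i j, ∀ t ∈ Finset.Icc 1 T, ∀ c : ℝ,
    Integrable (fun ω => Real.exp (c * M.η i j t ω)) P ∧
      P[fun ω => Real.exp (c * M.η i j t ω) | M.history t] ≤ᵐ[P]
        fun _ => Real.exp (c ^ 2 * R ^ 2 / 2)
  /-- The arm is drawn on the basis of `𝓕_{t-1}` and of internal randomness of the learner: given
  `𝓕_{t-1}`, the arm `a(t)` is independent of each error `η_{i,j}(t)`. -/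
  condIndep_arm : ∀ i j, ∀ t ∈ Finset.Icc 1 T, ∀ i' : Fin N, ∀ S : Set ℝ, MeasurableSet S →
    P[(M.arm t ⁻¹' {i'} ∩ M.η i j t ⁻¹' S).indicator (fun _ => (1 : ℝ)) | M.history t] =ᵐ[P]
      P[(M.arm t ⁻¹' {i'}).indicator (fun _ => (1 : ℝ)) | M.history t] *
        P[(M.η i j t ⁻¹' S).indicator (fun _ => (1 : ℝ)) | M.history t]

/-- `b̄(t) = 𝔼(b_{a(t)}(t) | 𝓕_{t-1})`. -/
def meanContext (M : GraphBandit Ω d N n) (P : Measure Ω) (t : ℕ) : Ω → EuclideanSpace ℝ (Fin d) :=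
  P[M.armContext t | M.history t]

/-- The centered context `b_i^c(t) = b_i(t) - b̄(t)`. -/
def centered (M : GraphBandit Ω d N n) (P : Measure Ω) (i : Fin N) (t : ℕ) (ω : Ω) :
    EuclideanSpace ℝ (Fin d) :=
  M.b i t ω - M.meanContext P t ω

/-- `X_t = b_{a(t)}(t) - 𝔼(b_{a(t)}(t) | 𝓕_{t-1})`. -/
def X (M : GraphBandit Ω d N n) (P : Measure Ω) (t : ℕ) (ω : Ω) : EuclideanSpace ℝ (Fin d) :=
  M.armContext t ω - M.meanContext P t ω

/-- `X_t X_tᵀ`. -/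
def outerX (M : GraphBandit Ω d N n) (P : Measure Ω) (t : ℕ) (ω : Ω) :
    Matrix (Fin d) (Fin d) ℝ :=
  Matrix.of fun p q => M.X P t ω p * M.X P t ω q

/-- `𝔼(X_t X_tᵀ | 𝓕_{t-1})`, taken entry by entry. -/
def condOuterX (M : GraphBandit Ω d N n) (P : Measure Ω) (t : ℕ) (ω : Ω) :
    Matrix (Fin d) (Fin d) ℝ :=
  Matrix.of fun p q => (P[fun ω' => M.outerX P t ω' p q | M.history t]) ω

/-- `B_k(t) = ∑_{τ ∈ 𝒯_{k,t-1}} X_τ X_τᵀ + ∑_{τ ∈ 𝒯_{k,t-1}} 𝔼(X_τ X_τᵀ | 𝓕_{τ-1}) + λ l_{kk} I_d`. -/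
def B (M : GraphBandit Ω d N n) (P : Measure Ω) (lam : ℝ) (k : Fin n) (t : ℕ) (ω : Ω) :
    Matrix (Fin d) (Fin d) ℝ :=
  ∑ τ ∈ M.served k (t - 1) ω, M.outerX P τ ω + ∑ τ ∈ M.served k (t - 1) ω, M.condOuterX P τ ω +
    (lam * rwLaplacian M.graph k k) • (1 : Matrix (Fin d) (Fin d) ℝ)

/-- The unadjusted estimator `μ̄_k(t) = B_k(t)⁻¹ ∑_{τ ∈ 𝒯_{k,t-1}} 2 X_τ r_{a(τ),k}(τ)`. -/
def muBar (M : GraphBandit Ω d N n) (P : Measure Ω) (lam : ℝ) (k : Fin n) (t : ℕ) (ω : Ω) :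
    EuclideanSpace ℝ (Fin d) :=
  matVec (M.B P lam k t ω)⁻¹
    (∑ τ ∈ M.served k (t - 1) ω, (2 * M.reward (M.arm τ ω) k τ ω) • M.X P τ ω)

/-- The graph-adjusted estimator `μ̂_j(t) = μ̄_j(t) - λ B_j(t)⁻¹ ∑_{k ≠ j} l_{jk} μ̄_k(t)`. -/
def muHat (M : GraphBandit Ω d N n) (P : Measure Ω) (lam : ℝ) (j : Fin n) (t : ℕ) (ω : Ω) :
    EuclideanSpace ℝ (Fin d) :=
  M.muBar P lam j t ω - lam • matVec (M.B P lam j t ω)⁻¹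
    (∑ k ∈ Finset.univ.erase j, rwLaplacian M.graph j k • M.muBar P lam k t ω)

/-- `Γ_j(t) = B_j(t) + λ² ∑_{k ≠ j} l_{jk}² B_k(t)⁻¹`. -/
def Gam (M : GraphBandit Ω d N n) (P : Measure Ω) (lam : ℝ) (j : Fin n) (t : ℕ) (ω : Ω) :
    Matrix (Fin d) (Fin d) ℝ :=
  M.B P lam j t ω + lam ^ 2 •
    ∑ k ∈ Finset.univ.erase j, rwLaplacian M.graph j k ^ 2 • (M.B P lam k t ω)⁻¹

end Model

/-- `α(t)`, as a function of the served user `j = j_t`. -/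
def alpha (M : GraphBandit Ω d N n) (R lam δ : ℝ) (j : Fin n) (t : ℕ) : ℝ :=
  (4 * R + 12) * Real.sqrt (2 * d * Real.log (24 * (t : ℝ) ^ 4 / δ * (1 + 1 / lam))) +
    Real.sqrt (2 * lam) * (1 + ‖M.Delta j‖)

end GraphBandit

end

/-! Fix `t`. In a round serving user `k`, the vector `2 r X` has conditional mean `2 𝔼(X Xᵀ) μ_k`:
since `X` is conditionally centered, the baseline and `b̄ᵀ μ_k` drop out, whatever their values.
Hence the score of user `k` is `(B_k - λ) μ_k + Z_k`, with `Z_k` a sum of martingale differences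
(`score_eq`). The two sums of outer products in `B_k` are exactly what self-normalization needs:
observed squares absorb fluctuations of the exponent, conditional squares absorb its second moment.

One round (`lintegral_mul_exp_exponent_le`): by conditional independence the arm may be averaged
under its conditional law, and the sub-Gaussian error integrated out; the remaining bounded part is
handled by `exp(y - y²/2) ≤ 1 + y + y²/2`. This gives, for each fixed `u`, an exponential
supermartingale with penalty `2R² + 8` times the quadratic form. Integrating over all `u` against a
Gaussian weight (`measure_exists_lt_le_of_lintegral_exp_le`) turns this into a bound uniform in the
direction.

A union over users would cost a factor `n`. The union is over rounds instead: before round `t`, a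
user has either never been served or has a first round `s < t`, and `s` identifies the rounds
serving that user (`served_eq_empty_or_roundsFrom`). Fewer than `t` events, each of probability at
most `δ/t³`, suffice, and all users are then controlled at once.

The rest is deterministic (`abs_inner_adjustedEstimator_sub_le`). The error of `μ̂_j` is `B_j⁻¹ Z_j`
plus `B_j⁻¹` applied to a bias in `Δ_j` and to terms averaged over neighbours. The `l_{jk}` with `k
≠ j` have absolute sum at most `1`, so `Γ_j` lies between `B_j` and `B_j + λ`, and duality of the
`Γ` and `Γ⁻¹` norms concludes. -/

/-! ### Conditional expectations and lower integrals -/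

/-- The ratio of the two sides is `1` at `0` and monotone on each side of it. Subtracting `x²/2` in
the exponent leaves a second-order bound valid for all real `x`, with no boundedness assumption. -/
theorem Real.exp_sub_sq_div_two_le (x : ℝ) : Real.exp (x - x ^ 2 / 2) ≤ 1 + x + x ^ 2 / 2 := by
  have hd : ∀ y : ℝ, HasDerivAt (fun y : ℝ => (1 + y + y ^ 2 / 2) * Real.exp (y ^ 2 / 2 - y))
      (y * (1 + y / 2 + y ^ 2 / 2) * Real.exp (y ^ 2 / 2 - y)) y := by
    intro y
    have h1 : HasDerivAt (fun y : ℝ => 1 + y + y ^ 2 / 2) (1 + y) y := by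
      simpa using ((hasDerivAt_id' y).const_add 1).fun_add (((hasDerivAt_id' y).pow 2).div_const 2)
    have h2 : HasDerivAt (fun y : ℝ => y ^ 2 / 2 - y) (y - 1) y := by
      simpa using (((hasDerivAt_id' y).pow 2).div_const 2).fun_sub (hasDerivAt_id' y)
    refine (h1.fun_mul h2.exp).congr_deriv ?_
    ring
  have hc : Continuous (fun y : ℝ => (1 + y + y ^ 2 / 2) * Real.exp (y ^ 2 / 2 - y)) := by
    fun_prop
  have hpos : ∀ y : ℝ, 0 < 1 + y / 2 + y ^ 2 / 2 := fun y => by nlinarith [sq_nonneg (y + 1 / 2)]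
  have key : 1 ≤ (1 + x + x ^ 2 / 2) * Real.exp (x ^ 2 / 2 - x) := by
    rcases le_total 0 x with hx | hx
    · have hm : MonotoneOn (fun y : ℝ => (1 + y + y ^ 2 / 2) * Real.exp (y ^ 2 / 2 - y))
          (Set.Ici 0) := by
        refine monotoneOn_of_deriv_nonneg (convex_Ici 0) hc.continuousOn
          (fun y _ => (hd y).differentiableAt.differentiableWithinAt) fun y hy => ?_
        rw [(hd y).deriv]
        have : 0 < y := by simpa using hy
        have := hpos y
        positivity
      simpa using hm (Set.mem_Ici.2 le_rfl) (Set.mem_Ici.2 hx) hx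
    · have hm : AntitoneOn (fun y : ℝ => (1 + y + y ^ 2 / 2) * Real.exp (y ^ 2 / 2 - y))
          (Set.Iic 0) := by
        refine antitoneOn_of_deriv_nonpos (convex_Iic 0) hc.continuousOn
          (fun y _ => (hd y).differentiableAt.differentiableWithinAt) fun y hy => ?_
        rw [(hd y).deriv]
        have hy0 : y < 0 := by simpa using hy
        exact mul_nonpos_of_nonpos_of_nonneg
          (mul_nonpos_of_nonpos_of_nonneg hy0.le (hpos y).le) (Real.exp_pos _).le
      simpa using hm (Set.mem_Iic.2 hx) (Set.mem_Iic.2 le_rfl) hx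
  calc Real.exp (x - x ^ 2 / 2)
      = 1 * Real.exp (x - x ^ 2 / 2) := (one_mul _).symm
    _ ≤ (1 + x + x ^ 2 / 2) * Real.exp (x ^ 2 / 2 - x) * Real.exp (x - x ^ 2 / 2) := by gcongr
    _ = 1 + x + x ^ 2 / 2 := by
      rw [mul_assoc, ← Real.exp_add]
      simp

/-- For a finite random variable `y` with law `p`, `𝔼 exp(y - y²/2) ≤ exp(𝔼 y + 𝔼 y² / 2)`. -/
theorem sum_mul_exp_sub_sq_div_two_le {ι : Type*} (s : Finset ι) (p y : ι → ℝ)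
    (hp : ∀ i ∈ s, 0 ≤ p i) (hp1 : ∑ i ∈ s, p i = 1) :
    ∑ i ∈ s, p i * Real.exp (y i - y i ^ 2 / 2) ≤
      Real.exp (∑ i ∈ s, p i * y i + (∑ i ∈ s, p i * y i ^ 2) / 2) := by
  calc ∑ i ∈ s, p i * Real.exp (y i - y i ^ 2 / 2)
      ≤ ∑ i ∈ s, p i * (1 + y i + y i ^ 2 / 2) := by
        refine Finset.sum_le_sum fun i hi => ?_
        exact mul_le_mul_of_nonneg_left (Real.exp_sub_sq_div_two_le _) (hp i hi)
    _ = (∑ i ∈ s, p i * y i + (∑ i ∈ s, p i * y i ^ 2) / 2) + 1 := by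
        conv_rhs => rw [← hp1]
        rw [Finset.sum_div, ← Finset.sum_add_distrib, ← Finset.sum_add_distrib]
        exact Finset.sum_congr rfl fun i _ => by ring
    _ ≤ _ := Real.add_one_le_exp _

/-- Two finite measures under which the pair `(X, Y)` has the same law on rectangles give the same
integrals to the functions of `(X, Y)`. -/
theorem lintegral_comp_congr_of_rectangles {Ω α β : Type*} [MeasurableSpace Ω] [MeasurableSpace α]
    [MeasurableSpace β] {μ ν : Measure Ω} [IsFiniteMeasure μ] {X : Ω → α} {Y : Ω → β}
    (hX : Measurable X) (hY : Measurable Y)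
    (hrect : ∀ s, MeasurableSet s → ∀ S, MeasurableSet S →
      μ (X ⁻¹' s ∩ Y ⁻¹' S) = ν (X ⁻¹' s ∩ Y ⁻¹' S))
    {φ : α × β → ENNReal} (hφ : Measurable φ) :
    ∫⁻ ω, φ (X ω, Y ω) ∂μ = ∫⁻ ω, φ (X ω, Y ω) ∂ν := by
  have hpair : Measurable fun ω => (X ω, Y ω) := hX.prodMk hY
  have hmap : μ.map (fun ω => (X ω, Y ω)) = ν.map (fun ω => (X ω, Y ω)) := by
    refine Measure.ext_prod fun {s S} hs hS => ?_
    rw [Measure.map_apply hpair (hs.prod hS), Measure.map_apply hpair (hs.prod hS)]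
    exact hrect s hs S hS
  rw [← lintegral_map hφ hpair, hmap, lintegral_map hφ hpair]

theorem measurable_mul_exp_mul {α : Type*} [MeasurableSpace α] {h : α → ENNReal}
    (hh : Measurable h) {c : α → ℝ} (hc : Measurable c) :
    Measurable fun q : α × ℝ => h q.1 * ENNReal.ofReal (Real.exp (c q.1 * q.2)) := by
  fun_prop

section CondExp

variable {Ω : Type*} {m mΩ : MeasurableSpace Ω} {P : Measure Ω}

/-- After restriction to `m`, the measure with density `f` is at most `c` times `P`. Comparing
measures rather than expectations lets `g` be unbounded, even infinite. -/
theorem lintegral_mul_ofReal_le_of_condExp_le [IsFiniteMeasure P] (hm : m ≤ mΩ) {f : Ω → ℝ}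
    (hf : Integrable f P) (h0 : 0 ≤ f) {c : ℝ} (hc : P[f | m] ≤ᵐ[P] fun _ => c)
    {g : Ω → ENNReal} (hg : Measurable[m] g) :
    ∫⁻ ω, g ω * ENNReal.ofReal (f ω) ∂P ≤ ENNReal.ofReal c * ∫⁻ ω, g ω ∂P := by
  have hle : (P.withDensity fun ω => ENNReal.ofReal (f ω)).trim hm ≤
      ENNReal.ofReal c • P.trim hm := by
    refine Measure.le_iff.2 fun s hs => ?_
    have hs' := hm s hs
    rw [Measure.smul_apply, trim_measurableSet_eq hm hs, trim_measurableSet_eq hm hs,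
      withDensity_apply _ hs', ← ofReal_integral_eq_lintegral_ofReal hf.integrableOn
        (Filter.Eventually.of_forall h0), ← setIntegral_condExp hm hf hs]
    calc ENNReal.ofReal (∫ ω in s, (P[f | m]) ω ∂P)
        ≤ ENNReal.ofReal (∫ _ in s, c ∂P) := by
          refine ENNReal.ofReal_le_ofReal (setIntegral_mono_ae integrable_condExp.integrableOn
            (integrable_const c).integrableOn hc)
      _ = ENNReal.ofReal c • P s := by
          rw [setIntegral_const, smul_eq_mul, ENNReal.ofReal_mul measureReal_nonneg,
            ofReal_measureReal, mul_comm, smul_eq_mul]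
  calc ∫⁻ ω, g ω * ENNReal.ofReal (f ω) ∂P
      = ∫⁻ ω, g ω ∂(P.withDensity fun ω => ENNReal.ofReal (f ω)) := by
        rw [lintegral_withDensity_eq_lintegral_mul₀ hf.aemeasurable.ennreal_ofReal
          (hg.mono hm le_rfl).aemeasurable]
        simp [mul_comm]
    _ = ∫⁻ ω, g ω ∂((P.withDensity fun ω => ENNReal.ofReal (f ω)).trim hm) :=
        (lintegral_trim hm hg).symm
    _ ≤ ∫⁻ ω, g ω ∂(ENNReal.ofReal c • P.trim hm) := lintegral_mono' hle le_rfl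
    _ = ENNReal.ofReal c * ∫⁻ ω, g ω ∂P := by
        rw [lintegral_smul_measure, lintegral_trim hm hg, smul_eq_mul]

/-- A conditionally sub-Gaussian variable stays so when multiplied by a variable known at the time
of conditioning. -/
theorem lintegral_mul_exp_mul_le_of_condExp_le [IsFiniteMeasure P] (hm : m ≤ mΩ) {η : Ω → ℝ}
    (hη : Measurable η) {R : ℝ}
    (hsub : ∀ c : ℝ, Integrable (fun ω => Real.exp (c * η ω)) P ∧
      P[fun ω => Real.exp (c * η ω) | m] ≤ᵐ[P] fun _ => Real.exp (c ^ 2 * R ^ 2 / 2))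
    {h : Ω → ENNReal} (hh : Measurable[m] h) {c : Ω → ℝ} (hc : Measurable[m] c) :
    ∫⁻ ω, h ω * ENNReal.ofReal (Real.exp (c ω * η ω)) ∂P ≤
      ∫⁻ ω, h ω * ENNReal.ofReal (Real.exp (c ω ^ 2 * R ^ 2 / 2)) ∂P := by
  -- simple multipliers
  have hsimple : ∀ s : @SimpleFunc Ω m ℝ, ∀ g : Ω → ENNReal, Measurable[m] g →
      ∫⁻ ω, g ω * ENNReal.ofReal (Real.exp (s ω * η ω)) ∂P ≤
      ∫⁻ ω, g ω * ENNReal.ofReal (Real.exp (s ω ^ 2 * R ^ 2 / 2)) ∂P := by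
    intro s g hg
    have hsplit : ∀ F : ℝ → Ω → ENNReal, ∀ ω,
        g ω * F (s ω) ω = ∑ z ∈ @SimpleFunc.range Ω ℝ m s, (s ⁻¹' {z}).indicator g ω * F z ω := by
      intro F ω
      rw [Finset.sum_eq_single (s ω)]
      · simp
      · intro z _ hz
        simp [Set.indicator, hz.symm]
      · intro hz
        exact absurd (@SimpleFunc.mem_range_self Ω ℝ m s ω) hz
    have hmeas : ∀ z : ℝ, Measurable[m] ((s ⁻¹' {z}).indicator g) := fun z =>
      hg.indicator (@SimpleFunc.measurableSet_fiber Ω ℝ m s z)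
    simp_rw [fun ω => hsplit (fun z ω => ENNReal.ofReal (Real.exp (z * η ω))) ω,
      fun ω => hsplit (fun z _ => ENNReal.ofReal (Real.exp (z ^ 2 * R ^ 2 / 2))) ω]
    have hm1 : ∀ z : ℝ, Measurable fun ω => (s ⁻¹' {z}).indicator g ω *
        ENNReal.ofReal (Real.exp (z * η ω)) := fun z =>
      ((hmeas z).mono hm le_rfl).mul (hη.const_mul z).exp.ennreal_ofReal
    have hm2 : ∀ z : ℝ, Measurable fun ω => (s ⁻¹' {z}).indicator g ω *
        ENNReal.ofReal (Real.exp (z ^ 2 * R ^ 2 / 2)) := fun z =>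
      ((hmeas z).mono hm le_rfl).mul_const _
    rw [lintegral_finsetSum _ fun z _ => hm1 z, lintegral_finsetSum _ fun z _ => hm2 z]
    refine Finset.sum_le_sum fun z _ => ?_
    rw [lintegral_mul_const _ ((hmeas z).mono hm le_rfl), mul_comm (lintegral _ _)]
    exact lintegral_mul_ofReal_le_of_condExp_le hm (hsub z).1 (fun ω => (Real.exp_pos _).le)
      (hsub z).2 (hmeas z)
  -- normalise by the bound, approximate the multiplier, and apply Fatou's lemma
  have hsm : StronglyMeasurable[m] c := hc.stronglyMeasurable
  -- After normalization the right-hand side no longer involves the multiplier, so Fatou on the left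
  -- is enough; no limit has to be taken on the right.
  have hnorm : ∀ s : @SimpleFunc Ω m ℝ, ∀ g : Ω → ENNReal, Measurable[m] g →
      ∫⁻ ω, g ω * ENNReal.ofReal (Real.exp (s ω * η ω - s ω ^ 2 * R ^ 2 / 2)) ∂P ≤
      ∫⁻ ω, g ω ∂P := by
    intro s g hg
    have hsm : Measurable[m] s := @SimpleFunc.measurable Ω ℝ m _ s
    have := hsimple s (fun ω => g ω * ENNReal.ofReal (Real.exp (-(s ω ^ 2 * R ^ 2 / 2))))
      (hg.mul (by fun_prop))
    convert this using 3 with ω ω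
    · rw [mul_assoc, ← ENNReal.ofReal_mul (Real.exp_pos _).le, ← Real.exp_add]
      congr 3; ring
    · rw [mul_assoc, ← ENNReal.ofReal_mul (Real.exp_pos _).le, ← Real.exp_add]
      simp
  have hfatou : ∀ g : Ω → ENNReal, Measurable[m] g →
      ∫⁻ ω, g ω * ENNReal.ofReal (Real.exp (c ω * η ω - c ω ^ 2 * R ^ 2 / 2)) ∂P ≤
      ∫⁻ ω, g ω ∂P := by
    intro g hg
    have hlim : ∀ ω, Filter.Tendsto (fun k => g ω * ENNReal.ofReal (Real.exp
        (hsm.approx k ω * η ω - hsm.approx k ω ^ 2 * R ^ 2 / 2))) Filter.atTop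
        (nhds (g ω * ENNReal.ofReal (Real.exp (c ω * η ω - c ω ^ 2 * R ^ 2 / 2)))) := by
      intro ω
      have h1 := hsm.tendsto_approx ω
      have h2 : Filter.Tendsto (fun k => ENNReal.ofReal (Real.exp
        (hsm.approx k ω * η ω - hsm.approx k ω ^ 2 * R ^ 2 / 2))) Filter.atTop
        (nhds (ENNReal.ofReal (Real.exp (c ω * η ω - c ω ^ 2 * R ^ 2 / 2)))) :=
        ((ENNReal.continuous_ofReal.comp (by fun_prop :
          Continuous fun x : ℝ => Real.exp (x * η ω - x ^ 2 * R ^ 2 / 2))).tendsto _).comp h1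
      exact ENNReal.Tendsto.const_mul h2 (Or.inl (by simp [Real.exp_pos]))
    calc ∫⁻ ω, g ω * ENNReal.ofReal (Real.exp (c ω * η ω - c ω ^ 2 * R ^ 2 / 2)) ∂P
        = ∫⁻ ω, Filter.liminf (fun k => g ω * ENNReal.ofReal (Real.exp
            (hsm.approx k ω * η ω - hsm.approx k ω ^ 2 * R ^ 2 / 2))) Filter.atTop ∂P :=
          lintegral_congr fun ω => (hlim ω).liminf_eq.symm
      _ ≤ Filter.liminf (fun k => ∫⁻ ω, g ω * ENNReal.ofReal (Real.exp
            (hsm.approx k ω * η ω - hsm.approx k ω ^ 2 * R ^ 2 / 2)) ∂P) Filter.atTop := by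
          refine lintegral_liminf_le fun k => (hg.mono hm le_rfl).mul ?_
          have : Measurable (hsm.approx k) := (@SimpleFunc.measurable Ω ℝ m _ (hsm.approx k)).mono hm le_rfl
          fun_prop
      _ ≤ Filter.liminf (fun _ : ℕ => ∫⁻ ω, g ω ∂P) Filter.atTop :=
          Filter.liminf_le_liminf (Filter.Eventually.of_forall fun k => hnorm _ g hg)
      _ = _ := Filter.liminf_const _
  have := hfatou (fun ω => h ω * ENNReal.ofReal (Real.exp (c ω ^ 2 * R ^ 2 / 2)))
    (hh.mul (by fun_prop))
  convert this using 3 with ω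
  rw [mul_assoc, ← ENNReal.ofReal_mul (Real.exp_pos _).le, ← Real.exp_add]
  congr 3; ring

/-- If an event and a random variable are conditionally independent given `m`, then inside
integrals over functions of the variable and of `m`, the event may be replaced by its conditional
probability. -/
theorem lintegral_indicator_mul_exp_eq [IsFiniteMeasure P] (hm : m ≤ mΩ) {A : Set Ω}
    (hA : MeasurableSet A) {η : Ω → ℝ} (hη : Measurable η)
    (hind : ∀ S : Set ℝ, MeasurableSet S →
      P[(A ∩ η ⁻¹' S).indicator (fun _ => (1 : ℝ)) | m] =ᵐ[P]
        P[A.indicator (fun _ => (1 : ℝ)) | m] * P[(η ⁻¹' S).indicator (fun _ => (1 : ℝ)) | m])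
    {h : Ω → ENNReal} (hh : Measurable[m] h) {c : Ω → ℝ} (hc : Measurable[m] c) :
    ∫⁻ ω in A, h ω * ENNReal.ofReal (Real.exp (c ω * η ω)) ∂P =
      ∫⁻ ω, ENNReal.ofReal ((P[A.indicator (fun _ => (1 : ℝ)) | m]) ω) *
        (h ω * ENNReal.ofReal (Real.exp (c ω * η ω))) ∂P := by
  set p : Ω → ℝ := P[A.indicator (fun _ => (1 : ℝ)) | m] with hp
  have hi : ∀ B : Set Ω, MeasurableSet B → Integrable (B.indicator fun _ => (1 : ℝ)) P :=
    fun B hB => (integrable_const 1).indicator hB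
  have hpm : Measurable[m] p := stronglyMeasurable_condExp.measurable
  have hp0 : 0 ≤ᵐ[P] p := condExp_nonneg (Filter.Eventually.of_forall fun ω =>
    Set.indicator_nonneg (fun _ _ => zero_le_one) ω)
  have hpi : Integrable p P := integrable_condExp
  have hpp : Measurable fun ω => ENNReal.ofReal (p ω) := (hpm.mono hm le_rfl).ennreal_ofReal
  -- `P` restricted to `A`, and `P` weighted by the conditional probability of `A`, agree on events
  -- `s ∩ η⁻¹ S` with `s` in `m`. Such rectangles determine the joint law of the identity into `(Ω,
  -- m)` and `η`.
  have hrect : ∀ s : Set Ω, MeasurableSet[m] s → ∀ S : Set ℝ, MeasurableSet S →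
      (P.restrict A) (s ∩ η ⁻¹' S) =
        (P.withDensity fun ω => ENNReal.ofReal (p ω)) (s ∩ η ⁻¹' S) := by
    intro s hs S hS
    have hs' := hm s hs
    have hS' := hη hS
    have hmul : Integrable (p * (η ⁻¹' S).indicator (fun _ => (1 : ℝ))) P := by
      have : p * (η ⁻¹' S).indicator (fun _ => (1 : ℝ)) = (η ⁻¹' S).indicator p := by
        ext ω; by_cases hω : ω ∈ η ⁻¹' S <;> simp [hω]
      rw [this]
      exact hpi.indicator hS'
    have hR : P.real (A ∩ (s ∩ η ⁻¹' S)) = ∫ ω in s ∩ η ⁻¹' S, p ω ∂P := by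
      calc P.real (A ∩ (s ∩ η ⁻¹' S))
          = ∫ ω in s, (A ∩ η ⁻¹' S).indicator (fun _ => (1 : ℝ)) ω ∂P := by
            rw [setIntegral_indicator (hA.inter hS'), setIntegral_const]
            simp only [smul_eq_mul, mul_one]
            congr 1; ext; simp; tauto
        _ = ∫ ω in s, (P[(A ∩ η ⁻¹' S).indicator (fun _ => (1 : ℝ)) | m]) ω ∂P :=
            (setIntegral_condExp hm (hi _ (hA.inter hS')) hs).symm
        _ = ∫ ω in s, (P[p * (η ⁻¹' S).indicator (fun _ => (1 : ℝ)) | m]) ω ∂P := by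
            refine setIntegral_congr_ae hs' ?_
            filter_upwards [hind S hS, condExp_mul_of_stronglyMeasurable_left
              (stronglyMeasurable_condExp : StronglyMeasurable[m] p) hmul (hi _ hS')] with ω h1 h2 _
            rw [h1, h2]
        _ = ∫ ω in s, (p * (η ⁻¹' S).indicator (fun _ => (1 : ℝ))) ω ∂P :=
            setIntegral_condExp hm hmul hs
        _ = ∫ ω in s ∩ η ⁻¹' S, p ω ∂P := by
            rw [← setIntegral_indicator hS']
            refine integral_congr_ae (Filter.Eventually.of_forall fun ω => ?_)
            by_cases hω : ω ∈ η ⁻¹' S <;> simp [hω]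
    rw [Measure.restrict_apply (hs'.inter hS'), Set.inter_comm _ A,
      withDensity_apply _ (hs'.inter hS'), ← ofReal_integral_eq_lintegral_ofReal hpi.integrableOn
        (ae_restrict_of_ae hp0), ← hR, ofReal_measureReal]
  calc ∫⁻ ω in A, h ω * ENNReal.ofReal (Real.exp (c ω * η ω)) ∂P
      = ∫⁻ ω, h ω * ENNReal.ofReal (Real.exp (c ω * η ω))
          ∂(P.withDensity fun ω => ENNReal.ofReal (p ω)) :=
        @lintegral_comp_congr_of_rectangles Ω Ω ℝ mΩ m _ (P.restrict A)
          (P.withDensity fun ω => ENNReal.ofReal (p ω)) _ id η (measurable_id.mono le_rfl hm) hη hrect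
          (fun q => h q.1 * ENNReal.ofReal (Real.exp (c q.1 * q.2)))
          (@measurable_mul_exp_mul Ω m h hh c hc)
    _ = _ := by
        rw [lintegral_withDensity_eq_lintegral_mul _ hpp]
        · rfl
        · exact (hh.mono hm le_rfl).mul
            (((hc.mono hm le_rfl).mul hη).exp.ennreal_ofReal)

/-- The conditional expectation of `f_a`, for a random index `a` and functions `f_i` known at the
time of conditioning. -/
theorem condExp_apply_index [IsFiniteMeasure P] {ι E : Type*} [Fintype ι]
    [MeasurableSpace ι] [MeasurableSingletonClass ι] [NormedAddCommGroup E] [NormedSpace ℝ E]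
    [CompleteSpace E] {a : Ω → ι} (ha : Measurable a) {f : ι → Ω → E}
    (hf : ∀ i, StronglyMeasurable[m] (f i)) (hfi : ∀ i, Integrable (f i) P) :
    P[fun ω => f (a ω) ω | m] =ᵐ[P]
      fun ω => ∑ i, (P[(a ⁻¹' {i}).indicator (fun _ => (1 : ℝ)) | m]) ω • f i ω := by
  classical
  have hA : ∀ i, MeasurableSet (a ⁻¹' {i}) := fun i => ha (measurableSet_singleton i)
  have hmul : ∀ i, (a ⁻¹' {i}).indicator (fun _ => (1 : ℝ)) • f i = (a ⁻¹' {i}).indicator (f i) := by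
    intro i; ext ω; by_cases hω : ω ∈ a ⁻¹' {i} <;> simp [hω]
  have hint : ∀ i, Integrable ((a ⁻¹' {i}).indicator (fun _ => (1 : ℝ)) • f i) P := fun i => by
    rw [hmul]; exact (hfi i).indicator (hA i)
  have heq : (fun ω => f (a ω) ω) = ∑ i, (a ⁻¹' {i}).indicator (fun _ => (1 : ℝ)) • f i := by
    ext ω
    rw [Finset.sum_apply, Finset.sum_eq_single (a ω)]
    · simp
    · intro i _ hi
      simp [hi.symm]
    · simp
  rw [heq]
  have hpull : ∀ᵐ ω ∂P, ∀ i, (P[(a ⁻¹' {i}).indicator (fun _ => (1 : ℝ)) • f i | m]) ω =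
      (P[(a ⁻¹' {i}).indicator (fun _ => (1 : ℝ)) | m]) ω • f i ω := by
    refine ae_all_iff.2 fun i => ?_
    exact condExp_smul_of_aestronglyMeasurable_right
      ((integrable_const (1 : ℝ)).indicator (hA i)) (hint i) (hf i).aestronglyMeasurable
  filter_upwards [condExp_finsetSum (s := Finset.univ) (fun i _ => hint i) m, hpull] with ω h1 h2
  rw [h1, Finset.sum_apply]
  exact Finset.sum_congr rfl fun i _ => h2 i

theorem sum_condExp_indicator_index [IsFiniteMeasure P] (hm : m ≤ mΩ) {ι : Type*} [Fintype ι]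
    [MeasurableSpace ι] [MeasurableSingletonClass ι] {a : Ω → ι} (ha : Measurable a) :
    ∀ᵐ ω ∂P, ∑ i, (P[(a ⁻¹' {i}).indicator (fun _ => (1 : ℝ)) | m]) ω = 1 := by
  have := condExp_apply_index (P := P) (m := m) ha (f := fun _ _ => (1 : ℝ))
    (fun _ => stronglyMeasurable_const) (fun _ => integrable_const 1)
  rw [condExp_const hm] at this
  filter_upwards [this] with ω h
  simpa using h.symm

end CondExp

/-! ### Quadratic forms of symmetric matrices -/

section MatVec

variable {d : ℕ}

theorem matVec_add (A : Matrix (Fin d) (Fin d) ℝ) (x y : EuclideanSpace ℝ (Fin d)) :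
    matVec A (x + y) = matVec A x + matVec A y := by
  simp [matVec, Matrix.mulVec_add]

theorem matVec_smul (A : Matrix (Fin d) (Fin d) ℝ) (c : ℝ) (x : EuclideanSpace ℝ (Fin d)) :
    matVec A (c • x) = c • matVec A x := by
  simp [matVec, Matrix.mulVec_smul]

theorem matVec_sub (A : Matrix (Fin d) (Fin d) ℝ) (x y : EuclideanSpace ℝ (Fin d)) :
    matVec A (x - y) = matVec A x - matVec A y := by
  simp [matVec, Matrix.mulVec_sub]

theorem add_matVec (A B : Matrix (Fin d) (Fin d) ℝ) (x : EuclideanSpace ℝ (Fin d)) :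
    matVec (A + B) x = matVec A x + matVec B x := by
  simp [matVec, Matrix.add_mulVec]

theorem smul_matVec (c : ℝ) (A : Matrix (Fin d) (Fin d) ℝ) (x : EuclideanSpace ℝ (Fin d)) :
    matVec (c • A) x = c • matVec A x := by
  simp [matVec, Matrix.smul_mulVec]

theorem one_matVec (x : EuclideanSpace ℝ (Fin d)) : matVec 1 x = x := by
  simp [matVec]

theorem sum_matVec {ι : Type*} (s : Finset ι) (A : ι → Matrix (Fin d) (Fin d) ℝ)
    (x : EuclideanSpace ℝ (Fin d)) :
    matVec (∑ i ∈ s, A i) x = ∑ i ∈ s, matVec (A i) x := by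
  classical
  induction s using Finset.induction_on with
  | empty => simp [matVec]
  | insert i s hi ih => rw [Finset.sum_insert hi, Finset.sum_insert hi, add_matVec, ih]

theorem matVec_matVec (A B : Matrix (Fin d) (Fin d) ℝ) (x : EuclideanSpace ℝ (Fin d)) :
    matVec A (matVec B x) = matVec (A * B) x := by
  simp [matVec, Matrix.mulVec_mulVec]

theorem inner_matVec_comm {A : Matrix (Fin d) (Fin d) ℝ} (hA : A.IsSymm)
    (x y : EuclideanSpace ℝ (Fin d)) :
    inner ℝ x (matVec A y) = inner ℝ (matVec A x) y := by
  simp only [matVec, EuclideanSpace.inner_eq_star_dotProduct, star_trivial]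
  rw [dotProduct_comm, Matrix.dotProduct_mulVec, ← Matrix.mulVec_transpose, hA.eq,
    dotProduct_comm]

/-- Coercivity makes the kernel trivial. -/
theorem isUnit_det_of_lower {A : Matrix (Fin d) (Fin d) ℝ} {c : ℝ} (hc : 0 < c)
    (hA : ∀ v, c * ‖v‖ ^ 2 ≤ inner ℝ v (matVec A v)) : IsUnit A.det := by
  rw [← Matrix.isUnit_iff_isUnit_det, ← Matrix.mulVec_injective_iff_isUnit]
  refine (injective_iff_map_eq_zero (Matrix.mulVecLin A)).2 fun v hv => ?_
  have h := hA (WithLp.toLp 2 v)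
  have h0 : matVec A (WithLp.toLp 2 v) = 0 := by
    simpa [matVec] using hv
  rw [h0, inner_zero_right] at h
  have : ‖WithLp.toLp 2 v‖ ^ 2 = 0 :=
    le_antisymm (nonpos_of_mul_nonpos_right h hc) (sq_nonneg _)
  simpa using this

theorem matVec_inv_matVec {A : Matrix (Fin d) (Fin d) ℝ} (hA : IsUnit A.det)
    (x : EuclideanSpace ℝ (Fin d)) : matVec A⁻¹ (matVec A x) = x := by
  rw [matVec_matVec, Matrix.nonsing_inv_mul _ hA, one_matVec]

theorem matVec_matVec_inv {A : Matrix (Fin d) (Fin d) ℝ} (hA : IsUnit A.det)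
    (x : EuclideanSpace ℝ (Fin d)) : matVec A (matVec A⁻¹ x) = x := by
  rw [matVec_matVec, Matrix.mul_nonsing_inv _ hA, one_matVec]

/-- The Cauchy–Schwarz inequality for a positive semidefinite matrix. -/
theorem inner_matVec_sq_le {A : Matrix (Fin d) (Fin d) ℝ} (hs : A.IsSymm)
    (h0 : ∀ v, 0 ≤ inner ℝ v (matVec A v)) (x y : EuclideanSpace ℝ (Fin d)) :
    inner ℝ x (matVec A y) ^ 2 ≤ inner ℝ x (matVec A x) * inner ℝ y (matVec A y) := by
  have hq : ∀ r : ℝ, 0 ≤ inner ℝ y (matVec A y) * (r * r) +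
      2 * inner ℝ x (matVec A y) * r + inner ℝ x (matVec A x) := by
    intro r
    have h := h0 (x + r • y)
    have hc : inner ℝ y (matVec A x) = inner ℝ x (matVec A y) := by
      rw [inner_matVec_comm hs, real_inner_comm]
    simp only [matVec_add, matVec_smul, inner_add_left, inner_add_right, inner_smul_left,
      inner_smul_right, RCLike.conj_to_real, hc] at h
    linarith
  have := discrim_le_zero hq
  rw [discrim] at this
  nlinarith

theorem weightedNorm_nonneg (A : Matrix (Fin d) (Fin d) ℝ) (x : EuclideanSpace ℝ (Fin d)) :
    0 ≤ weightedNorm A x := Real.sqrt_nonneg _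

theorem weightedNorm_add_le {A : Matrix (Fin d) (Fin d) ℝ} (hs : A.IsSymm)
    (h0 : ∀ v, 0 ≤ inner ℝ v (matVec A v)) (x y : EuclideanSpace ℝ (Fin d)) :
    weightedNorm A (x + y) ≤ weightedNorm A x + weightedNorm A y := by
  refine Real.sqrt_le_iff.2 ⟨add_nonneg (weightedNorm_nonneg _ _) (weightedNorm_nonneg _ _), ?_⟩
  have hc : inner ℝ y (matVec A x) = inner ℝ x (matVec A y) := by
    rw [inner_matVec_comm hs, real_inner_comm]
  have hcs : inner ℝ x (matVec A y) ≤ weightedNorm A x * weightedNorm A y := by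
    rw [weightedNorm, weightedNorm, ← Real.sqrt_mul (h0 x)]
    exact Real.le_sqrt_of_sq_le (inner_matVec_sq_le hs h0 x y)
  have hx : weightedNorm A x ^ 2 = inner ℝ x (matVec A x) := Real.sq_sqrt (h0 x)
  have hy : weightedNorm A y ^ 2 = inner ℝ y (matVec A y) := Real.sq_sqrt (h0 y)
  simp only [matVec_add, inner_add_left, inner_add_right, hc]
  nlinarith

/-- The duality of `‖·‖_A` and `‖·‖_{A⁻¹}`. -/
theorem abs_inner_le_weightedNorm_inv_mul {A : Matrix (Fin d) (Fin d) ℝ} (hs : A.IsSymm)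
    {c : ℝ} (hc : 0 < c) (hA : ∀ v, c * ‖v‖ ^ 2 ≤ inner ℝ v (matVec A v))
    (x y : EuclideanSpace ℝ (Fin d)) :
    |inner ℝ x y| ≤ weightedNorm A⁻¹ x * weightedNorm A y := by
  have h0 : ∀ v, 0 ≤ inner ℝ v (matVec A v) := fun v => le_trans (by positivity) (hA v)
  have hu := isUnit_det_of_lower hc hA
  have h := inner_matVec_sq_le hs h0 (matVec A⁻¹ x) y
  rw [inner_matVec_comm hs, matVec_matVec_inv hu, real_inner_comm x] at h
  have h0x : 0 ≤ inner ℝ x (matVec A⁻¹ x) := by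
    have := h0 (matVec A⁻¹ x)
    rwa [matVec_matVec_inv hu, real_inner_comm] at this
  rw [weightedNorm, weightedNorm, ← Real.sqrt_mul h0x]
  exact Real.abs_le_sqrt h

/-- Bounds for `y = A⁻¹ q`, when `A` is at least `c`. -/
theorem norm_sq_matVec_inv_le {A : Matrix (Fin d) (Fin d) ℝ} {c : ℝ} (hc : 0 < c)
    (hA : ∀ v, c * ‖v‖ ^ 2 ≤ inner ℝ v (matVec A v)) (q : EuclideanSpace ℝ (Fin d)) :
    c * ‖matVec A⁻¹ q‖ ≤ ‖q‖ := by
  have hu := isUnit_det_of_lower hc hA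
  have h := hA (matVec A⁻¹ q)
  rw [matVec_matVec_inv hu] at h
  have h2 := real_inner_le_norm (matVec A⁻¹ q) q
  rcases (norm_nonneg (matVec A⁻¹ q)).eq_or_lt with h0 | h0
  · rw [← h0]; simp
  · by_contra! hlt
    nlinarith

end MatVec


/-! ### Deterministic error bound for the graph-adjusted estimator -/

section Estimator

variable {d : ℕ} {ι : Type*}

/-- The matrix `B + λ² ∑_k l_k² B_k⁻¹` is symmetric, at least `B`, and at most `B + λ`. -/
theorem adjustedMatrix_bounds {B : Matrix (Fin d) (Fin d) ℝ} (hBs : B.IsSymm) (s : Finset ι)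
    {Bk : ι → Matrix (Fin d) (Fin d) ℝ} (hBks : ∀ k ∈ s, (Bk k).IsSymm) {lam : ℝ} (hlam : 0 < lam)
    (hBk : ∀ k ∈ s, ∀ v, lam * ‖v‖ ^ 2 ≤ inner ℝ v (matVec (Bk k) v))
    {l : ι → ℝ} (hl : ∑ k ∈ s, |l k| ≤ 1) :
    (B + lam ^ 2 • ∑ k ∈ s, l k ^ 2 • (Bk k)⁻¹).IsSymm ∧
    (∀ v, inner ℝ v (matVec B v) ≤
      inner ℝ v (matVec (B + lam ^ 2 • ∑ k ∈ s, l k ^ 2 • (Bk k)⁻¹) v)) ∧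
    ∀ v, inner ℝ v (matVec (B + lam ^ 2 • ∑ k ∈ s, l k ^ 2 • (Bk k)⁻¹) v) ≤
      inner ℝ v (matVec B v) + lam * ‖v‖ ^ 2 := by
  have hexp : ∀ v, inner ℝ v (matVec (B + lam ^ 2 • ∑ k ∈ s, l k ^ 2 • (Bk k)⁻¹) v) =
      inner ℝ v (matVec B v) + lam ^ 2 * ∑ k ∈ s, l k ^ 2 * inner ℝ v (matVec (Bk k)⁻¹ v) := by
    intro v
    simp only [add_matVec, smul_matVec, sum_matVec, inner_add_right, inner_smul_right, inner_sum]
  have hbd : ∀ k ∈ s, ∀ v, 0 ≤ inner ℝ v (matVec (Bk k)⁻¹ v) ∧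
      lam * inner ℝ v (matVec (Bk k)⁻¹ v) ≤ ‖v‖ ^ 2 := by
    intro k hk v
    have hu := isUnit_det_of_lower hlam (hBk k hk)
    have h1 := hBk k hk (matVec (Bk k)⁻¹ v)
    rw [matVec_matVec_inv hu, real_inner_comm] at h1
    have h2 := norm_sq_matVec_inv_le hlam (hBk k hk) v
    have h3 := real_inner_le_norm v (matVec (Bk k)⁻¹ v)
    refine ⟨le_trans (by positivity) h1, ?_⟩
    calc lam * inner ℝ v (matVec (Bk k)⁻¹ v) ≤ lam * (‖v‖ * ‖matVec (Bk k)⁻¹ v‖) := by gcongr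
      _ = ‖v‖ * (lam * ‖matVec (Bk k)⁻¹ v‖) := by ring
      _ ≤ ‖v‖ * ‖v‖ := by gcongr
      _ = ‖v‖ ^ 2 := (sq _).symm
  refine ⟨?_, fun v => ?_, fun v => ?_⟩
  · refine hBs.add (Matrix.IsSymm.smul ?_ _)
    rw [Matrix.IsSymm, Matrix.transpose_sum]
    refine Finset.sum_congr rfl fun k hk => ?_
    rw [Matrix.transpose_smul, Matrix.transpose_nonsing_inv, (hBks k hk).eq]
  · rw [hexp]
    have : 0 ≤ ∑ k ∈ s, l k ^ 2 * inner ℝ v (matVec (Bk k)⁻¹ v) :=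
      Finset.sum_nonneg fun k hk => mul_nonneg (sq_nonneg _) (hbd k hk v).1
    have := mul_nonneg (sq_nonneg lam) this
    linarith
  · rw [hexp]
    have hl1 : ∀ k ∈ s, l k ^ 2 ≤ |l k| := by
      intro k hk
      have : |l k| ≤ 1 :=
        (Finset.single_le_sum (f := fun k => |l k|) (fun _ _ => abs_nonneg _) hk).trans hl
      rw [← sq_abs]
      nlinarith [abs_nonneg (l k)]
    have : lam ^ 2 * ∑ k ∈ s, l k ^ 2 * inner ℝ v (matVec (Bk k)⁻¹ v) ≤ lam * ‖v‖ ^ 2 := by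
      calc lam ^ 2 * ∑ k ∈ s, l k ^ 2 * inner ℝ v (matVec (Bk k)⁻¹ v)
          = lam * ∑ k ∈ s, l k ^ 2 * (lam * inner ℝ v (matVec (Bk k)⁻¹ v)) := by
            rw [Finset.mul_sum, Finset.mul_sum]
            exact Finset.sum_congr rfl fun k _ => by ring
        _ ≤ lam * ∑ k ∈ s, |l k| * ‖v‖ ^ 2 := by
            gcongr with k hk
            · exact mul_nonneg hlam.le (hbd k hk v).1
            · exact hl1 k hk
            · exact (hbd k hk v).2
        _ = lam * ((∑ k ∈ s, |l k|) * ‖v‖ ^ 2) := by rw [Finset.sum_mul]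
        _ ≤ lam * (1 * ‖v‖ ^ 2) := by gcongr
        _ = lam * ‖v‖ ^ 2 := by rw [one_mul]
    linarith

theorem norm_sum_smul_le (s : Finset ι) {l : ι → ℝ} (hl : ∑ k ∈ s, |l k| ≤ 1)
    {y : ι → EuclideanSpace ℝ (Fin d)} {c : ℝ} (hc : 0 ≤ c) (hy : ∀ k ∈ s, ‖y k‖ ≤ c) :
    ‖∑ k ∈ s, l k • y k‖ ≤ c := by
  calc ‖∑ k ∈ s, l k • y k‖ ≤ ∑ k ∈ s, |l k| * c := by
        refine norm_sum_le_of_le _ fun k hk => ?_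
        rw [norm_smul, Real.norm_eq_abs]
        exact mul_le_mul_of_nonneg_left (hy k hk) (abs_nonneg _)
    _ = (∑ k ∈ s, |l k|) * c := by rw [Finset.sum_mul]
    _ ≤ 1 * c := by gcongr
    _ = c := one_mul _

/-- Error of the graph-adjusted ridge estimator, when the noise `Z_k` of every user is controlled
in the dual of the quadratic form `B_k - (3/4) λ`. -/
theorem abs_inner_adjustedEstimator_sub_le [DecidableEq ι] (s : Finset ι) {j : ι}
    {B : ι → Matrix (Fin d) (Fin d) ℝ} (hBs : ∀ k, (B k).IsSymm) {lam : ℝ} (hlam : 0 < lam)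
    (hB : ∀ k v, lam * ‖v‖ ^ 2 ≤ inner ℝ v (matVec (B k) v))
    {l : ι → ℝ} (hl : ∑ k ∈ s, |l k| ≤ 1) {μ S Z : ι → EuclideanSpace ℝ (Fin d)}
    (hμ : ∀ k, ‖μ k‖ ≤ 1) (hS : ∀ k, S k = matVec (B k) (μ k) - lam • μ k + Z k)
    {K : ℝ} (hK : 0 ≤ K)
    (hZ : ∀ k v, 2 * inner ℝ v (Z k) - inner ℝ v (matVec (B k) v) + 3 / 4 * lam * ‖v‖ ^ 2 ≤ K ^ 2)
    (x : EuclideanSpace ℝ (Fin d)) :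
    |inner ℝ x (matVec (B j)⁻¹ (S j) - lam • matVec (B j)⁻¹
        (∑ k ∈ s, l k • matVec (B k)⁻¹ (S k)) - μ j)| ≤
      weightedNorm (B j + lam ^ 2 • ∑ k ∈ s, l k ^ 2 • (B k)⁻¹)⁻¹ x *
        (2 * K + Real.sqrt (2 * lam) * (1 + ‖μ j + ∑ k ∈ s, l k • μ k‖)) := by
  obtain ⟨hΓs, hΓ1, hΓ2⟩ := adjustedMatrix_bounds (hBs j) s (fun k _ => hBs k) hlam
    (fun k _ => hB k) hl
  set Γ := B j + lam ^ 2 • ∑ k ∈ s, l k ^ 2 • (B k)⁻¹ with hΓdef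
  have hΓ : ∀ v, lam * ‖v‖ ^ 2 ≤ inner ℝ v (matVec Γ v) := fun v => (hB j v).trans (hΓ1 v)
  have hΓ0 : ∀ v, 0 ≤ inner ℝ v (matVec Γ v) := fun v => le_trans (by positivity) (hΓ v)
  have hu : ∀ k, IsUnit (B k).det := fun k => isUnit_det_of_lower hlam (hB k)
  have hμb : ∀ k, matVec (B k)⁻¹ (S k) = μ k - lam • matVec (B k)⁻¹ (μ k) + matVec (B k)⁻¹ (Z k) := by
    intro k
    rw [hS, matVec_add, matVec_sub, matVec_inv_matVec (hu k), matVec_smul]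
  set Δ := μ j + ∑ k ∈ s, l k • μ k with hΔ
  set y1 := matVec (B j)⁻¹ (Z j) with hy1
  set q2 := ∑ k ∈ s, l k • matVec (B k)⁻¹ (μ k) with hq2
  set q3 := ∑ k ∈ s, l k • matVec (B k)⁻¹ (Z k) with hq3
  have hdecomp : matVec (B j)⁻¹ (S j) - lam • matVec (B j)⁻¹
        (∑ k ∈ s, l k • matVec (B k)⁻¹ (S k)) - μ j =
      y1 + matVec (B j)⁻¹ ((-lam) • Δ + lam ^ 2 • q2 + (-lam) • q3) := by
    have hsum : ∑ k ∈ s, l k • matVec (B k)⁻¹ (S k) = (Δ - μ j) - lam • q2 + q3 := by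
      rw [hΔ, add_sub_cancel_left, hq2, hq3, Finset.smul_sum, ← Finset.sum_sub_distrib,
        ← Finset.sum_add_distrib]
      refine Finset.sum_congr rfl fun k _ => ?_
      rw [hμb, smul_add, smul_sub, smul_comm lam]
    rw [hsum, hμb]
    simp only [matVec_add, matVec_sub, matVec_smul]
    module
  -- With `y = B_j⁻¹ q`, the form of `Γ` at `y` is at most `⟨y, q⟩ + λ ‖y‖²`, and `λ ‖y‖ ≤ ‖q‖`
  -- bounds both terms by `‖q‖² / λ`.
  have hlin : ∀ q, weightedNorm Γ (matVec (B j)⁻¹ q) ≤ Real.sqrt (2 / lam) * ‖q‖ := by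
    intro q
    have h1 := hΓ2 (matVec (B j)⁻¹ q)
    have h2 := hB j (matVec (B j)⁻¹ q)
    rw [matVec_matVec_inv (hu j)] at h1 h2
    have h3 := real_inner_le_norm (matVec (B j)⁻¹ q) q
    have h4 := norm_sq_matVec_inv_le hlam (hB j) q
    rw [weightedNorm, ← Real.sqrt_sq (norm_nonneg q), ← Real.sqrt_mul (by positivity)]
    refine Real.sqrt_le_sqrt ?_
    rw [div_mul_eq_mul_div, le_div_iff₀ hlam]
    nlinarith [norm_nonneg q]
  have hZ1 : ∀ k, lam * ‖matVec (B k)⁻¹ (Z k)‖ ^ 2 * 3 ≤ K ^ 2 := by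
    intro k
    -- At `v = 2 B_k⁻¹ Z_k` the linear and quadratic terms cancel, leaving only `3 λ ‖B_k⁻¹ Z_k‖²`.
    have h := hZ k ((2 : ℝ) • matVec (B k)⁻¹ (Z k))
    simp only [matVec_smul, matVec_matVec_inv (hu k), inner_smul_left, inner_smul_right,
      norm_smul, mul_pow, RCLike.conj_to_real, Real.norm_eq_abs, abs_two] at h
    linarith
  -- The hypothesis at `v = y1` gives `⟨y1, Z_j⟩ + λ ‖y1‖² ≤ K² + λ ‖y1‖² / 4`, hence at most
  -- `(13/12) K² ≤ (21/20)² K²`. Together with the `5/6` coming from the neighbours' noise, the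
  -- coefficient of `K` stays below `2`.
  have hy1b : weightedNorm Γ y1 ≤ 21 / 20 * K := by
    refine Real.sqrt_le_iff.2 ⟨by positivity, ?_⟩
    have h := hZ j y1
    have h1 := hΓ2 y1
    have h2 := hZ1 j
    rw [hy1, matVec_matVec_inv (hu j)] at h h1
    rw [hy1]
    nlinarith [sq_nonneg K]
  have hq2b : ‖q2‖ ≤ 1 / lam := by
    refine norm_sum_smul_le s hl (by positivity) fun k _ => ?_
    rw [le_div_iff₀ hlam, mul_comm]
    exact (norm_sq_matVec_inv_le hlam (hB k) (μ k)).trans (hμ k)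
  have hq3b : ‖q3‖ ≤ K * Real.sqrt (1 / (3 * lam)) := by
    refine norm_sum_smul_le s hl (by positivity) fun k _ => ?_
    rw [← Real.sqrt_sq hK, ← Real.sqrt_mul (sq_nonneg K)]
    refine Real.le_sqrt_of_sq_le ?_
    rw [mul_one_div, le_div_iff₀ (by positivity)]
    linarith [hZ1 k]
  have hs2 : lam * Real.sqrt (2 / lam) = Real.sqrt (2 * lam) := by
    rw [← Real.sqrt_sq hlam.le, ← Real.sqrt_mul (sq_nonneg lam), Real.sqrt_sq hlam.le]
    congr 1
    field_simp
  have hs3 : Real.sqrt (2 * lam) * Real.sqrt (1 / (3 * lam)) ≤ 5 / 6 := by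
    rw [← Real.sqrt_mul (by positivity)]
    refine Real.sqrt_le_iff.2 ⟨by norm_num, ?_⟩
    rw [mul_one_div, div_le_iff₀ (by positivity)]
    nlinarith
  have hqb : weightedNorm Γ (matVec (B j)⁻¹ ((-lam) • Δ + lam ^ 2 • q2 + (-lam) • q3)) ≤
      Real.sqrt (2 * lam) * (1 + ‖Δ‖) + 5 / 6 * K := by
    calc _ ≤ Real.sqrt (2 / lam) * ‖(-lam) • Δ + lam ^ 2 • q2 + (-lam) • q3‖ := hlin _
      _ ≤ Real.sqrt (2 / lam) * (lam * ‖Δ‖ + lam ^ 2 * (1 / lam) +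
            lam * (K * Real.sqrt (1 / (3 * lam)))) := by
          gcongr
          refine norm_add₃_le.trans ?_
          rw [norm_smul, norm_smul, norm_smul, norm_neg, norm_pow, Real.norm_eq_abs,
            abs_of_pos hlam]
          gcongr
      _ = lam * Real.sqrt (2 / lam) * (1 + ‖Δ‖) +
            (lam * Real.sqrt (2 / lam) * Real.sqrt (1 / (3 * lam))) * K := by
          field_simp
          ring
      _ ≤ _ := by
          rw [hs2]
          gcongr
  rw [hdecomp]
  refine (abs_inner_le_weightedNorm_inv_mul hΓs hlam hΓ _ _).trans ?_
  refine mul_le_mul_of_nonneg_left ?_ (weightedNorm_nonneg _ _)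
  refine (weightedNorm_add_le hΓs hΓ0 _ _).trans ?_
  linarith

end Estimator

/-! ### The method of mixtures -/

section Mixture

variable {d : ℕ}

theorem continuous_matVec (A : Matrix (Fin d) (Fin d) ℝ) : Continuous (matVec A) :=
  (PiLp.continuous_toLp 2 _).comp
    (Continuous.matrix_mulVec continuous_const (PiLp.continuous_ofLp 2 _))

theorem inner_matVec_eq_sum (A : Matrix (Fin d) (Fin d) ℝ) (x y : EuclideanSpace ℝ (Fin d)) :
    inner ℝ x (matVec A y) = ∑ i, ∑ j, x i * (A i j * y j) := by
  simp only [PiLp.inner_apply, matVec, Matrix.mulVec, dotProduct, RCLike.inner_apply,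
    RCLike.conj_to_real, Finset.sum_mul]
  exact Finset.sum_congr rfl fun i _ => Finset.sum_congr rfl fun j _ => by ring

theorem lintegral_exp_neg_mul_norm_sq {b : ℝ} (hb : 0 < b) :
    ∫⁻ u : EuclideanSpace ℝ (Fin d), ENNReal.ofReal (Real.exp (-b * ‖u‖ ^ 2)) =
      ENNReal.ofReal ((Real.pi / b) ^ (d / 2 : ℝ)) := by
  have h := GaussianFourier.integral_rexp_neg_mul_sq_norm (V := EuclideanSpace ℝ (Fin d)) hb
  rw [finrank_euclideanSpace_fin] at h
  rw [← h, ofReal_integral_eq_lintegral_ofReal _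
    (Filter.Eventually.of_forall fun u => (Real.exp_pos _).le)]
  -- A non-integrable function would have integral `0` by convention, whereas the Gaussian value is
  -- positive.
  by_contra hni
  rw [integral_undef hni] at h
  have : 0 < (Real.pi / b) ^ (d / 2 : ℝ) := Real.rpow_pos_of_pos (by positivity) _
  linarith

/-- A Gaussian integral is at least the value of the integrand at any point `v` times the centered
integral. -/
theorem exp_mul_lintegral_le_lintegral_exp {A : Matrix (Fin d) (Fin d) ℝ} (hA : A.IsSymm) {b : ℝ}
    (hb : ∀ u, inner ℝ u (matVec A u) ≤ b * ‖u‖ ^ 2) (z v : EuclideanSpace ℝ (Fin d)) :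
    ENNReal.ofReal (Real.exp (inner ℝ v z - inner ℝ v (matVec A v))) *
      ∫⁻ u : EuclideanSpace ℝ (Fin d), ENNReal.ofReal (Real.exp (-b * ‖u‖ ^ 2)) ≤
    ∫⁻ u : EuclideanSpace ℝ (Fin d),
      ENNReal.ofReal (Real.exp (inner ℝ u z - inner ℝ u (matVec A u))) := by
  set F : EuclideanSpace ℝ (Fin d) → ℝ := fun u => inner ℝ u z - inner ℝ u (matVec A u) with hF
  have hFc : Continuous F := by
    have := continuous_matVec A
    fun_prop
  have hm : Measurable fun u => ENNReal.ofReal (Real.exp (F u)) :=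
    (Real.continuous_exp.comp hFc).measurable.ennreal_ofReal
  -- Around `v` the exponent is `F v - wᵀ A w` plus a term `r` odd in `w`. Averaging over `±w`
  -- removes `r`, because `exp r + exp (-r) ≥ 2`; no completion of the square or determinant is
  -- needed.
  have hpt : ∀ w, 2 * (Real.exp (F v) * Real.exp (-b * ‖w‖ ^ 2)) ≤
      Real.exp (F (v + w)) + Real.exp (F (v - w)) := by
    intro w
    have hc : inner ℝ w (matVec A v) = inner ℝ v (matVec A w) := by
      rw [inner_matVec_comm hA, real_inner_comm]
    set r : ℝ := inner ℝ w z - 2 * inner ℝ v (matVec A w) with hr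
    have h1 : F (v + w) = F v - inner ℝ w (matVec A w) + r := by
      simp only [hF, hr, matVec_add, inner_add_left, inner_add_right, hc]; ring
    have h2 : F (v - w) = F v - inner ℝ w (matVec A w) - r := by
      simp only [hF, hr, matVec_sub, inner_sub_left, inner_sub_right, hc]; ring
    have h3 : Real.exp (F v) * Real.exp (-b * ‖w‖ ^ 2) ≤
        Real.exp (F v - inner ℝ w (matVec A w)) := by
      rw [← Real.exp_add]
      exact Real.exp_le_exp.2 (by linarith [hb w])
    have h4 : 2 ≤ Real.exp r + Real.exp (-r) := by
      linarith [Real.add_one_le_exp r, Real.add_one_le_exp (-r)]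
    calc 2 * (Real.exp (F v) * Real.exp (-b * ‖w‖ ^ 2))
        ≤ 2 * Real.exp (F v - inner ℝ w (matVec A w)) := by linarith
      _ ≤ (Real.exp r + Real.exp (-r)) * Real.exp (F v - inner ℝ w (matVec A w)) := by gcongr
      _ = _ := by
        rw [h1, h2, sub_eq_add_neg _ r, Real.exp_add _ r, Real.exp_add _ (-r)]; ring
  have hplus : ∫⁻ w, ENNReal.ofReal (Real.exp (F (v + w))) =
      ∫⁻ u, ENNReal.ofReal (Real.exp (F u)) :=
    lintegral_add_left_eq_self (fun u => ENNReal.ofReal (Real.exp (F u))) v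
  have hminus : ∫⁻ w, ENNReal.ofReal (Real.exp (F (v - w))) =
      ∫⁻ u, ENNReal.ofReal (Real.exp (F u)) :=
    lintegral_sub_left_eq_self (fun u => ENNReal.ofReal (Real.exp (F u))) v
  have h2 : 2 * (ENNReal.ofReal (Real.exp (F v)) *
      ∫⁻ u : EuclideanSpace ℝ (Fin d), ENNReal.ofReal (Real.exp (-b * ‖u‖ ^ 2))) ≤
      2 * ∫⁻ u, ENNReal.ofReal (Real.exp (F u)) := by
    rw [two_mul (∫⁻ u, ENNReal.ofReal (Real.exp (F u)))]
    nth_rewrite 1 [← hplus]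
    have hm' : Measurable fun w => ENNReal.ofReal (Real.exp (F (v + w))) :=
      hm.comp (measurable_const_add v)
    rw [← hminus, ← lintegral_add_left hm',
      ← lintegral_const_mul _ (by fun_prop), ← lintegral_const_mul _ (by fun_prop)]
    refine lintegral_mono fun w => ?_
    rw [← ENNReal.ofReal_add (Real.exp_pos _).le (Real.exp_pos _).le,
      ← ENNReal.ofReal_mul (Real.exp_pos _).le]
    calc _ = ENNReal.ofReal (2 * (Real.exp (F v) * Real.exp (-b * ‖w‖ ^ 2))) := by
          rw [ENNReal.ofReal_mul zero_le_two, ENNReal.ofReal_ofNat]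
      _ ≤ _ := ENNReal.ofReal_le_ofReal (hpt w)
  exact (ENNReal.mul_le_mul_iff_right two_ne_zero ENNReal.ofNat_ne_top).1 h2

/-- Self-normalized tail bound, by the method of mixtures. -/
theorem measure_exists_lt_le_of_lintegral_exp_le {Ω : Type*} [MeasurableSpace Ω] {P : Measure Ω}
    [IsProbabilityMeasure P] {Z : Ω → EuclideanSpace ℝ (Fin d)} (hZ : Measurable Z)
    {W : Ω → Matrix (Fin d) (Fin d) ℝ} (hW : ∀ i j, Measurable fun ω => W ω i j)
    (hWs : ∀ ω, (W ω).IsSymm) {b : ℝ} (hb0 : 0 ≤ b)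
    (hWb : ∀ᵐ ω ∂P, ∀ u, inner ℝ u (matVec (W ω) u) ≤ b * ‖u‖ ^ 2) {c : ℝ} (hc : 0 < c)
    (hexp : ∀ u, ∫⁻ ω, ENNReal.ofReal
      (Real.exp (inner ℝ u (Z ω) - c * inner ℝ u (matVec (W ω) u))) ∂P ≤ 1)
    {ρ : ℝ} (hρ : 0 < ρ) {p : ℝ} (hp : 0 < p) :
    P {ω | ∃ v, 4 * c * (Real.log (1 / p) + d / 2 * Real.log ((ρ + b) / ρ)) <
      2 * inner ℝ v (Z ω) - inner ℝ v (matVec (W ω) v) - ρ * ‖v‖ ^ 2} ≤ ENNReal.ofReal p := by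
  set Λ : ℝ := Real.log (1 / p) + d / 2 * Real.log ((ρ + b) / ρ) with hΛ
  set f : Ω → EuclideanSpace ℝ (Fin d) → ENNReal := fun ω u => ENNReal.ofReal
    (Real.exp (inner ℝ u (Z ω) - c * inner ℝ u (matVec (W ω) u) - c * ρ * ‖u‖ ^ 2)) with hf
  have hfm : Measurable (Function.uncurry f) := by
    simp only [hf, Function.uncurry_def, inner_matVec_eq_sum]
    have h1 : Measurable fun q : Ω × EuclideanSpace ℝ (Fin d) =>
        ∑ i, ∑ j, q.2 i * (W q.1 i j * q.2 j) := by
      refine Finset.measurable_fun_sum _ fun i _ => Finset.measurable_fun_sum _ fun j _ => ?_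
      have h2 : Measurable fun q : Ω × EuclideanSpace ℝ (Fin d) => W q.1 i j :=
        (hW i j).comp measurable_fst
      have h3 : ∀ i, Measurable fun q : Ω × EuclideanSpace ℝ (Fin d) => q.2 i := fun i => by
        fun_prop
      exact (h3 i).mul (h2.mul (h3 j))
    have h4 : Measurable fun q : Ω × EuclideanSpace ℝ (Fin d) => inner ℝ q.2 (Z q.1) :=
      measurable_snd.inner (hZ.comp measurable_fst)
    exact (((h4.sub (h1.const_mul c)).sub
      ((measurable_snd.norm.pow_const 2).const_mul _)).exp).ennreal_ofReal
  have htotal : ∫⁻ ω, (∫⁻ u, f ω u) ∂P ≤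
      ENNReal.ofReal ((Real.pi / (c * ρ)) ^ (d / 2 : ℝ)) := by
    rw [lintegral_lintegral_swap hfm.aemeasurable, ← lintegral_exp_neg_mul_norm_sq (by positivity)]
    refine lintegral_mono fun u => ?_
    calc ∫⁻ ω, f ω u ∂P = ∫⁻ ω, ENNReal.ofReal (Real.exp (-(c * ρ) * ‖u‖ ^ 2)) * ENNReal.ofReal
          (Real.exp (inner ℝ u (Z ω) - c * inner ℝ u (matVec (W ω) u))) ∂P := by
          refine lintegral_congr fun ω => ?_
          rw [← ENNReal.ofReal_mul (Real.exp_pos _).le, ← Real.exp_add]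
          simp only [hf]
          congr 2; ring
      _ = ENNReal.ofReal (Real.exp (-(c * ρ) * ‖u‖ ^ 2)) * ∫⁻ ω, ENNReal.ofReal
          (Real.exp (inner ℝ u (Z ω) - c * inner ℝ u (matVec (W ω) u))) ∂P :=
          lintegral_const_mul' _ _ ENNReal.ofReal_ne_top
      _ ≤ ENNReal.ofReal (Real.exp (-(c * ρ) * ‖u‖ ^ 2)) * 1 := by gcongr; exact hexp u
      _ = _ := mul_one _
  -- The mixture has total mass at most `(π/(cρ))^(d/2)`, and `Λ` is chosen so that this equals `thr
  -- * p`; Markov's inequality then yields `p`.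
  set thr : ENNReal := ENNReal.ofReal (Real.exp Λ) *
    ENNReal.ofReal ((Real.pi / (c * (ρ + b))) ^ (d / 2 : ℝ)) with hthr
  have hsub : {ω | ∃ v, 4 * c * Λ < 2 * inner ℝ v (Z ω) - inner ℝ v (matVec (W ω) v) -
      ρ * ‖v‖ ^ 2} ≤ᵐ[P] {ω | thr ≤ ∫⁻ u, f ω u} := by
    filter_upwards [hWb] with ω hω
    rintro ⟨v, hv⟩
    have hAs : (c • W ω + (c * ρ) • (1 : Matrix (Fin d) (Fin d) ℝ)).IsSymm :=
      ((hWs ω).smul _).add (Matrix.isSymm_one.smul _)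
    have hAe : ∀ u, inner ℝ u (matVec (c • W ω + (c * ρ) • (1 : Matrix (Fin d) (Fin d) ℝ)) u) =
        c * inner ℝ u (matVec (W ω) u) + c * ρ * ‖u‖ ^ 2 := by
      intro u
      rw [add_matVec, smul_matVec, smul_matVec, one_matVec, inner_add_right, inner_smul_right,
        inner_smul_right, real_inner_self_eq_norm_sq]
    -- The point `v / (2c)` turns the exponent into the quadratic expression of the event divided by
    -- `4c`.
    have h := exp_mul_lintegral_le_lintegral_exp hAs (b := c * (ρ + b)) (fun u => by
      rw [hAe]
      nlinarith [mul_le_mul_of_nonneg_left (hω u) hc.le]) (Z ω) ((1 / (2 * c)) • v)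
    rw [lintegral_exp_neg_mul_norm_sq (by positivity)] at h
    simp only [hAe] at h
    refine le_trans ?_ (h.trans_eq (lintegral_congr fun u => ?_))
    · rw [hthr]
      gcongr
      rw [matVec_smul, inner_smul_left, inner_smul_left, inner_smul_right, norm_smul, mul_pow,
        Real.norm_eq_abs, sq_abs, RCLike.conj_to_real]
      have : 1 / (2 * c) * inner ℝ v (Z ω) - (c * (1 / (2 * c) * (1 / (2 * c) *
          inner ℝ v (matVec (W ω) v))) + c * ρ * ((1 / (2 * c)) ^ 2 * ‖v‖ ^ 2)) =
          (2 * inner ℝ v (Z ω) - inner ℝ v (matVec (W ω) v) - ρ * ‖v‖ ^ 2) / (4 * c) := by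
        field_simp
        ring
      rw [this, le_div_iff₀ (by positivity)]
      linarith
    · rw [hf]
      congr 2; ring
  have hmarkov := mul_meas_ge_le_lintegral₀ (μ := P) (f := fun ω => ∫⁻ u, f ω u)
    hfm.lintegral_prod_right'.aemeasurable thr
  have hG : 0 < (Real.pi / (c * (ρ + b))) ^ (d / 2 : ℝ) := Real.rpow_pos_of_pos (by positivity) _
  have hthr0 : thr ≠ 0 := by
    rw [hthr, ← ENNReal.ofReal_mul (Real.exp_pos _).le]
    simpa using mul_pos (Real.exp_pos Λ) hG
  have hthrt : thr ≠ ⊤ := ENNReal.mul_ne_top ENNReal.ofReal_ne_top ENNReal.ofReal_ne_top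
  have hval : ENNReal.ofReal ((Real.pi / (c * ρ)) ^ (d / 2 : ℝ)) = thr * ENNReal.ofReal p := by
    rw [hthr, ← ENNReal.ofReal_mul (Real.exp_pos _).le,
      ← ENNReal.ofReal_mul (mul_pos (Real.exp_pos Λ) hG).le]
    congr 1
    have h1 : Real.exp Λ = 1 / p * ((ρ + b) / ρ) ^ (d / 2 : ℝ) := by
      rw [hΛ, Real.exp_add, Real.exp_log (by positivity), Real.rpow_def_of_pos (by positivity),
        mul_comm (Real.log _)]
    have h2 : Real.pi / (c * ρ) = (ρ + b) / ρ * (Real.pi / (c * (ρ + b))) := by field_simp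
    rw [h1, h2, Real.mul_rpow (by positivity) (by positivity)]
    field_simp
  calc _ ≤ P {ω | thr ≤ ∫⁻ u, f ω u} := measure_mono_ae hsub
    _ ≤ ENNReal.ofReal p := by
      refine (ENNReal.mul_le_mul_iff_right hthr0 hthrt).1 ?_
      exact (hmarkov.trans htotal).trans_eq hval

end Mixture

/-! ### One round of the bandit -/

theorem Measurable.apply_index {Ω ι β : Type*} [MeasurableSpace Ω] [MeasurableSpace ι]
    [Countable ι] [MeasurableSingletonClass ι] [MeasurableSpace β] {f : ι → Ω → β}
    (hf : ∀ i, Measurable (f i)) {a : Ω → ι} (ha : Measurable a) :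
    Measurable fun ω => f (a ω) ω :=
  (measurable_from_prod_countable_right (f := fun q : ι × Ω => f q.1 q.2) hf).comp
    (ha.prodMk measurable_id)

theorem measurable_matVec {Ω : Type*} [MeasurableSpace Ω] {d : ℕ}
    {A : Ω → Matrix (Fin d) (Fin d) ℝ} (hA : ∀ i j, Measurable fun ω => A ω i j)
    {v : Ω → EuclideanSpace ℝ (Fin d)} (hv : Measurable v) :
    Measurable fun ω => matVec (A ω) (v ω) := by
  refine (PiLp.continuous_toLp 2 _).measurable.comp (measurable_pi_iff.2 fun i => ?_)
  simp only [Matrix.mulVec, dotProduct]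
  have : ∀ j, Measurable fun ω => v ω j := fun j => by fun_prop
  exact Finset.measurable_fun_sum _ fun j _ => (hA i j).mul (this j)

/-- The scalar inequality behind the exponential supermartingale: `p` is the law of the arm. -/
theorem sum_mul_exp_le_one {ι : Type*} (t : Finset ι) {p s m : ι → ℝ} {f Cm Cs κ : ℝ}
    (hp : ∀ i ∈ t, 0 ≤ p i) (hp1 : ∑ i ∈ t, p i = 1) (hs : ∑ i ∈ t, p i * s i = 0)
    (hm : ∑ i ∈ t, p i * (s i * m i) = Cm) (hs2 : ∑ i ∈ t, p i * (s i * s i) = Cs)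
    (hg : ∀ i ∈ t, |m i + f| ≤ 4) (hκ : 8 ≤ κ) :
    ∑ i ∈ t, p i * Real.exp (s i * (m i + f) - Cm - 8 * s i ^ 2 - κ * Cs) ≤ 1 := by
  have hsq : ∀ i ∈ t, (s i * (m i + f)) ^ 2 ≤ 16 * s i ^ 2 := by
    intro i hi
    have : (m i + f) ^ 2 ≤ 4 ^ 2 := sq_le_sq' (abs_le.1 (hg i hi)).1 (abs_le.1 (hg i hi)).2
    rw [mul_pow]
    nlinarith [sq_nonneg (s i)]
  have hCs : 0 ≤ Cs := by
    rw [← hs2]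
    exact Finset.sum_nonneg fun i hi => mul_nonneg (hp i hi) (mul_self_nonneg _)
  calc ∑ i ∈ t, p i * Real.exp (s i * (m i + f) - Cm - 8 * s i ^ 2 - κ * Cs)
      ≤ ∑ i ∈ t, p i * Real.exp (s i * (m i + f) - (s i * (m i + f)) ^ 2 / 2) *
          Real.exp (-Cm - κ * Cs) := by
        refine Finset.sum_le_sum fun i hi => ?_
        rw [mul_assoc, ← Real.exp_add]
        refine mul_le_mul_of_nonneg_left (Real.exp_le_exp.2 ?_) (hp i hi)
        linarith [hsq i hi]
    _ = (∑ i ∈ t, p i * Real.exp (s i * (m i + f) - (s i * (m i + f)) ^ 2 / 2)) *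
          Real.exp (-Cm - κ * Cs) := by rw [Finset.sum_mul]
    _ ≤ Real.exp (∑ i ∈ t, p i * (s i * (m i + f)) +
          (∑ i ∈ t, p i * (s i * (m i + f)) ^ 2) / 2) * Real.exp (-Cm - κ * Cs) := by
        gcongr
        exact sum_mul_exp_sub_sq_div_two_le t p _ hp hp1
    _ ≤ 1 := by
        rw [← Real.exp_add, Real.exp_le_one_iff]
        have h1 : ∑ i ∈ t, p i * (s i * (m i + f)) = Cm := by
          calc _ = ∑ i ∈ t, p i * (s i * m i) + (∑ i ∈ t, p i * s i) * f := by
                rw [Finset.sum_mul, ← Finset.sum_add_distrib]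
                exact Finset.sum_congr rfl fun i _ => by ring
            _ = Cm := by rw [hs, hm]; ring
        have h2 : ∑ i ∈ t, p i * (s i * (m i + f)) ^ 2 ≤ 16 * Cs := by
          rw [← hs2, Finset.mul_sum]
          refine Finset.sum_le_sum fun i hi => ?_
          calc p i * (s i * (m i + f)) ^ 2 ≤ p i * (16 * s i ^ 2) :=
                mul_le_mul_of_nonneg_left (hsq i hi) (hp i hi)
            _ = 16 * (p i * (s i * s i)) := by ring
        rw [h1]
        nlinarith

namespace GraphBandit

variable {Ω : Type*} {d N n : ℕ}

section Measurability

variable (M : GraphBandit Ω d N n)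

theorem shown_le_history (t : ℕ) : M.shown t ≤ M.history t := le_sup_left

/-- The condition `1 ≤ s` matters: round `0` never enters a later history. -/
theorem history_mono {s t : ℕ} (hs : 1 ≤ s) (hst : s ≤ t) : M.history s ≤ M.history t := by
  rcases hst.eq_or_lt with rfl | hlt
  · exact le_rfl
  have hle : ∀ τ ∈ Finset.Ico 1 t,
      (M.shown τ ⊔ MeasurableSpace.comap (M.arm τ) inferInstance ⊔
        MeasurableSpace.comap (M.obsReward τ) inferInstance) ≤ M.history t := fun τ hτ =>
    le_sup_of_le_right (le_iSup₂_of_le τ hτ le_rfl)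
  refine sup_le ?_ (iSup₂_le fun τ hτ => hle τ ?_)
  · exact (le_sup_left.trans le_sup_left).trans (hle s (Finset.mem_Ico.2 ⟨hs, hlt⟩))
  · rw [Finset.mem_Ico] at hτ ⊢
    exact ⟨hτ.1, hτ.2.trans hlt⟩

theorem measurable_user_history (t : ℕ) : Measurable[M.history t] (M.user t) :=
  Measurable.of_comap_le (le_sup_left.trans (M.shown_le_history t))

theorem measurable_b_history (i : Fin N) (t : ℕ) : Measurable[M.history t] (M.b i t) :=
  Measurable.of_comap_le ((le_sup_of_le_right
    (le_iSup (fun i => MeasurableSpace.comap (M.b i t) inferInstance) i)).trans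
      (M.shown_le_history t))

theorem measurable_arm_history {s t : ℕ} (hs : 1 ≤ s) (hst : s < t) :
    Measurable[M.history t] (M.arm s) :=
  Measurable.of_comap_le (le_sup_of_le_right
    (le_iSup₂_of_le s (Finset.mem_Ico.2 ⟨hs, hst⟩) (le_sup_right.trans le_sup_left)))

theorem measurable_obsReward_history {s t : ℕ} (hs : 1 ≤ s) (hst : s < t) :
    Measurable[M.history t] (M.obsReward s) :=
  Measurable.of_comap_le (le_sup_of_le_right
    (le_iSup₂_of_le s (Finset.mem_Ico.2 ⟨hs, hst⟩) le_sup_right))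

end Measurability

section Model

variable {mΩ : MeasurableSpace Ω} {P : Measure Ω} {M : GraphBandit Ω d N n} {R : ℝ} {T : ℕ}

/-- Strong induction is forced by the baseline: its measurability is known only relative to the
history of its own round, and the observed reward built on it enters later histories. -/
theorem IsSemiparametric.history_le (hM : M.IsSemiparametric P R T) :
    ∀ t ∈ Finset.Icc 1 T, M.history t ≤ mΩ := by
  intro t
  induction t using Nat.strong_induction_on with
  | _ t ih =>
    intro ht
    have hshown : ∀ τ ∈ Finset.Icc 1 T, M.shown τ ≤ mΩ := fun τ hτ =>
      sup_le (hM.measurable_user τ hτ).comap_le (iSup_le fun i => (hM.measurable_b i τ hτ).comap_le)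
    refine sup_le (hshown t ht) (iSup₂_le fun τ hτ => ?_)
    have hτ' := Finset.mem_Ico.1 hτ
    have hτT : τ ∈ Finset.Icc 1 T :=
      Finset.mem_Icc.2 ⟨hτ'.1, hτ'.2.le.trans (Finset.mem_Icc.1 ht).2⟩
    refine sup_le (sup_le (hshown τ hτT) (hM.measurable_arm τ hτT).comap_le) ?_
    refine Measurable.comap_le ?_
    have hr : ∀ i j, Measurable (M.reward i j τ) := fun i j =>
      (((hM.measurable_ν j τ hτT).mono (ih τ hτ'.2 hτT) le_rfl).add
        ((hM.measurable_b i τ hτT).inner_const)).add (hM.measurable_η i j τ hτT)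
    exact Measurable.apply_index (f := fun i ω => M.reward i (M.user τ ω) τ ω)
      (fun i => Measurable.apply_index (f := fun j => M.reward i j τ) (hr i)
        (hM.measurable_user τ hτT)) (hM.measurable_arm τ hτT)

theorem measurable_meanContext (t : ℕ) : Measurable[M.history t] (M.meanContext P t) :=
  stronglyMeasurable_condExp.measurable

theorem measurable_condOuterX (t : ℕ) (p q : Fin d) :
    Measurable[M.history t] fun ω => M.condOuterX P t ω p q :=
  stronglyMeasurable_condExp.measurable

theorem measurable_centered (i : Fin N) (t : ℕ) : Measurable[M.history t] (M.centered P i t) :=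
  (M.measurable_b_history i t).sub (measurable_meanContext t)

theorem measurable_X_history {s t : ℕ} (hs : 1 ≤ s) (hst : s < t) :
    Measurable[M.history t] (M.X P s) :=
  @Measurable.apply_index Ω (Fin N) _ (M.history t) _ _ _ _ (fun i => M.centered P i s)
    (fun i => (measurable_centered i s).mono (M.history_mono hs hst.le) le_rfl) (M.arm s)
    (M.measurable_arm_history hs hst)

/-- The quadratic form of round `t` which normalizes its noise. -/
noncomputable def variation (M : GraphBandit Ω d N n) (P : Measure Ω) (t : ℕ) (ω : Ω) :
    Matrix (Fin d) (Fin d) ℝ :=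
  M.outerX P t ω + M.condOuterX P t ω

/-- The noise that round `t` adds to the score of the served user. -/
noncomputable def noise (M : GraphBandit Ω d N n) (P : Measure Ω) (t : ℕ) (ω : Ω) : EuclideanSpace ℝ (Fin d) :=
  (2 * M.obsReward t ω) • M.X P t ω - matVec (M.variation P t ω) (M.μ (M.user t ω))

theorem measurable_variation_history {s t : ℕ} (hs : 1 ≤ s) (hst : s < t) (p q : Fin d) :
    Measurable[M.history t] fun ω => M.variation P s ω p q := by
  have hX : ∀ p, Measurable[M.history t] fun ω => M.X P s ω p := fun p =>
    (by fun_prop : Measurable fun v : EuclideanSpace ℝ (Fin d) => v p).comp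
      (measurable_X_history hs hst)
  exact ((hX p).mul (hX q)).add
    ((measurable_condOuterX s p q).mono (M.history_mono hs hst.le) le_rfl)

theorem measurable_noise_history {s t : ℕ} (hs : 1 ≤ s) (hst : s < t) :
    Measurable[M.history t] (M.noise P s) := by
  have h1 : Measurable[M.history t] fun ω => M.μ (M.user s ω) :=
    (measurable_from_top (f := M.μ)).comp
      ((M.measurable_user_history s).mono (M.history_mono hs hst.le) le_rfl)
  exact (((M.measurable_obsReward_history hs hst).const_mul 2).smul
    (measurable_X_history hs hst)).sub
    (@measurable_matVec Ω (M.history t) d _ (measurable_variation_history hs hst) _ h1)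

theorem isSymm_variation (t : ℕ) (ω : Ω) : (M.variation P t ω).IsSymm := by
  ext p q
  simp only [variation, outerX, condOuterX, Matrix.transpose_apply, Matrix.add_apply,
    Matrix.of_apply, mul_comm]

theorem matVec_outerX (t : ℕ) (ω : Ω) (v : EuclideanSpace ℝ (Fin d)) :
    matVec (M.outerX P t ω) v = inner ℝ (M.X P t ω) v • M.X P t ω := by
  ext p
  simp only [matVec, outerX, Matrix.mulVec, dotProduct, Matrix.of_apply, PiLp.smul_apply,
    PiLp.inner_apply, RCLike.inner_apply, RCLike.conj_to_real, smul_eq_mul, Finset.sum_mul]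
  exact Finset.sum_congr rfl fun q _ => by ring

theorem inner_variation (t : ℕ) (ω : Ω) (u v : EuclideanSpace ℝ (Fin d)) :
    inner ℝ u (matVec (M.variation P t ω) v) =
      inner ℝ u (M.X P t ω) * inner ℝ (M.X P t ω) v +
        inner ℝ u (matVec (M.condOuterX P t ω) v) := by
  rw [variation, add_matVec, matVec_outerX, inner_add_right, inner_smul_right, mul_comm]

/-- The conditional law of the arm. -/
noncomputable def armLaw (M : GraphBandit Ω d N n) (P : Measure Ω) (t : ℕ) (i : Fin N) : Ω → ℝ :=
  P[(M.arm t ⁻¹' {i}).indicator (fun _ => (1 : ℝ)) | M.history t]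

theorem ae_armLaw_nonneg (t : ℕ) : ∀ᵐ ω ∂P, ∀ i, 0 ≤ M.armLaw P t i ω :=
  ae_all_iff.2 fun _ => condExp_nonneg (Filter.Eventually.of_forall fun ω =>
    Set.indicator_nonneg (fun _ _ => zero_le_one) ω)

variable [IsProbabilityMeasure P]

theorem IsSemiparametric.ae_sum_armLaw (hM : M.IsSemiparametric P R T) {t : ℕ}
    (ht : t ∈ Finset.Icc 1 T) : ∀ᵐ ω ∂P, ∑ i, M.armLaw P t i ω = 1 :=
  sum_condExp_indicator_index (hM.history_le t ht) (hM.measurable_arm t ht)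

/-- The contexts are known before the arm is drawn, so conditional expectations are finite averages
under `armLaw`. This removes the need for regular conditional distributions. -/
theorem IsSemiparametric.ae_meanContext (hM : M.IsSemiparametric P R T) {t : ℕ}
    (ht : t ∈ Finset.Icc 1 T) :
    ∀ᵐ ω ∂P, M.meanContext P t ω = ∑ i, M.armLaw P t i ω • M.b i t ω := by
  refine condExp_apply_index (hM.measurable_arm t ht)
    (fun i => (M.measurable_b_history i t).stronglyMeasurable) fun i => ?_
  exact Integrable.of_bound (hM.measurable_b i t ht).aestronglyMeasurable 1
    (Filter.Eventually.of_forall (hM.norm_b_le i t ht))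

theorem IsSemiparametric.ae_norm_meanContext_le (hM : M.IsSemiparametric P R T) {t : ℕ}
    (ht : t ∈ Finset.Icc 1 T) : ∀ᵐ ω ∂P, ‖M.meanContext P t ω‖ ≤ 1 := by
  filter_upwards [hM.ae_meanContext ht, hM.ae_sum_armLaw ht, ae_armLaw_nonneg (M := M) (P := P) t]
    with ω h1 h2 h3
  rw [h1]
  refine norm_sum_smul_le _ ?_ zero_le_one fun i _ => hM.norm_b_le i t ht ω
  rw [← h2]
  exact Finset.sum_le_sum fun i _ => (abs_of_nonneg (h3 i)).le

theorem IsSemiparametric.ae_norm_centered_le (hM : M.IsSemiparametric P R T) {t : ℕ}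
    (ht : t ∈ Finset.Icc 1 T) : ∀ᵐ ω ∂P, ∀ i, ‖M.centered P i t ω‖ ≤ 2 := by
  filter_upwards [hM.ae_norm_meanContext_le ht] with ω h i
  have h1 := norm_sub_le (M.b i t ω) (M.meanContext P t ω)
  have h2 := hM.norm_b_le i t ht ω
  rw [centered]
  linarith

theorem IsSemiparametric.ae_condOuterX (hM : M.IsSemiparametric P R T) {t : ℕ}
    (ht : t ∈ Finset.Icc 1 T) :
    ∀ᵐ ω ∂P, ∀ p q, M.condOuterX P t ω p q =
      ∑ i, M.armLaw P t i ω * (M.centered P i t ω p * M.centered P i t ω q) := by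
  refine ae_all_iff.2 fun p => ae_all_iff.2 fun q => ?_
  have hm : ∀ i, Measurable[M.history t] fun ω => M.centered P i t ω p * M.centered P i t ω q :=
    fun i => by
      have hc : ∀ p, Measurable[M.history t] fun ω => M.centered P i t ω p := fun p =>
        (by fun_prop : Measurable fun v : EuclideanSpace ℝ (Fin d) => v p).comp
          (measurable_centered i t)
      exact (hc p).mul (hc q)
  have := condExp_apply_index (P := P) (m := M.history t) (hM.measurable_arm t ht)
    (f := fun i ω => M.centered P i t ω p * M.centered P i t ω q)
    (fun i => (hm i).stronglyMeasurable) fun i => ?_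
  · exact this
  · refine Integrable.of_bound ((hm i).mono (hM.history_le t ht) le_rfl).aestronglyMeasurable
      (2 * 2) ?_
    filter_upwards [hM.ae_norm_centered_le ht] with ω h
    rw [norm_mul]
    have h1 := (PiLp.norm_apply_le (M.centered P i t ω) p).trans (h i)
    have h2 := (PiLp.norm_apply_le (M.centered P i t ω) q).trans (h i)
    gcongr

theorem IsSemiparametric.ae_inner_condOuterX (hM : M.IsSemiparametric P R T) {t : ℕ}
    (ht : t ∈ Finset.Icc 1 T) :
    ∀ᵐ ω ∂P, ∀ u v, inner ℝ u (matVec (M.condOuterX P t ω) v) =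
      ∑ i, M.armLaw P t i ω * (inner ℝ u (M.centered P i t ω) * inner ℝ (M.centered P i t ω) v) := by
  filter_upwards [hM.ae_condOuterX ht] with ω h u v
  have hi : ∀ i, M.armLaw P t i ω *
      (inner ℝ u (M.centered P i t ω) * inner ℝ (M.centered P i t ω) v) =
      ∑ p, ∑ q, u p * (M.armLaw P t i ω *
        (M.centered P i t ω p * M.centered P i t ω q) * v q) := by
    intro i
    simp only [PiLp.inner_apply, RCLike.inner_apply, RCLike.conj_to_real]
    rw [Finset.sum_mul_sum, Finset.mul_sum]
    refine Finset.sum_congr rfl fun p _ => ?_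
    rw [Finset.mul_sum]
    exact Finset.sum_congr rfl fun q _ => by ring
  rw [Finset.sum_congr rfl fun i _ => hi i, Finset.sum_comm, inner_matVec_eq_sum]
  refine Finset.sum_congr rfl fun p _ => ?_
  rw [Finset.sum_comm]
  refine Finset.sum_congr rfl fun q _ => ?_
  rw [h, Finset.sum_mul, Finset.mul_sum]

theorem IsSemiparametric.ae_variation_bounds (hM : M.IsSemiparametric P R T) {t : ℕ}
    (ht : t ∈ Finset.Icc 1 T) :
    ∀ᵐ ω ∂P, ∀ u, 0 ≤ inner ℝ u (matVec (M.variation P t ω) u) ∧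
      inner ℝ u (matVec (M.variation P t ω) u) ≤ 8 * ‖u‖ ^ 2 := by
  filter_upwards [hM.ae_inner_condOuterX ht, hM.ae_sum_armLaw ht,
    ae_armLaw_nonneg (M := M) (P := P) t, hM.ae_norm_centered_le ht] with ω h1 h2 h3 h4 u
  rw [inner_variation, h1]
  have hsq : ∀ i, inner ℝ u (M.centered P i t ω) * inner ℝ (M.centered P i t ω) u ≤
      4 * ‖u‖ ^ 2 := by
    intro i
    rw [real_inner_comm u]
    have h5 := abs_real_inner_le_norm u (M.centered P i t ω)
    have h6 : |inner ℝ u (M.centered P i t ω)| ≤ ‖u‖ * 2 :=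
      h5.trans (mul_le_mul_of_nonneg_left (h4 i) (norm_nonneg _))
    rw [← abs_mul_abs_self]
    nlinarith [abs_nonneg (inner ℝ u (M.centered P i t ω)), norm_nonneg u]
  have hsq0 : ∀ i, 0 ≤ inner ℝ u (M.centered P i t ω) * inner ℝ (M.centered P i t ω) u := by
    intro i
    rw [real_inner_comm u]
    exact mul_self_nonneg _
  have hX : M.X P t ω = M.centered P (M.arm t ω) t ω := rfl
  constructor
  · exact add_nonneg (hX ▸ hsq0 _)
      (Finset.sum_nonneg fun i _ => mul_nonneg (h3 i) (hsq0 i))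
  · have : ∑ i, M.armLaw P t i ω * (inner ℝ u (M.centered P i t ω) *
        inner ℝ (M.centered P i t ω) u) ≤ 4 * ‖u‖ ^ 2 := by
      calc _ ≤ ∑ i, M.armLaw P t i ω * (4 * ‖u‖ ^ 2) :=
            Finset.sum_le_sum fun i _ => mul_le_mul_of_nonneg_left (hsq i) (h3 i)
        _ = 4 * ‖u‖ ^ 2 := by rw [← Finset.sum_mul, h2, one_mul]
    have := hsq (M.arm t ω)
    rw [hX]
    linarith

end Model

end GraphBandit

/-! ### The exponential supermartingale -/

namespace GraphBandit

variable {Ω : Type*} {d N n : ℕ} {mΩ : MeasurableSpace Ω} {P : Measure Ω}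
  {M : GraphBandit Ω d N n} {R : ℝ} {T : ℕ}

/-- The exponent of the one-round exponential supermartingale. -/
noncomputable def exponent (M : GraphBandit Ω d N n) (P : Measure Ω) (R : ℝ)
    (u : EuclideanSpace ℝ (Fin d)) (t : ℕ) (ω : Ω) : ℝ :=
  inner ℝ u (M.noise P t ω) - (2 * R ^ 2 + 8) * inner ℝ u (matVec (M.variation P t ω) u)

/-- The part of the exponent that is known before the arm is drawn, if arm `i` is then pulled for
user `j`. -/
noncomputable def predictableExponent (M : GraphBandit Ω d N n) (P : Measure Ω) (R : ℝ)
    (u : EuclideanSpace ℝ (Fin d)) (i : Fin N) (j : Fin n) (t : ℕ) (ω : Ω) : ℝ :=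
  inner ℝ u (M.centered P i t ω) *
      (inner ℝ (M.centered P i t ω) (M.μ j) +
        2 * (M.ν j t ω + inner ℝ (M.meanContext P t ω) (M.μ j))) -
    inner ℝ u (matVec (M.condOuterX P t ω) (M.μ j)) -
    (2 * R ^ 2 + 8) * (inner ℝ u (M.centered P i t ω) ^ 2 +
      inner ℝ u (matVec (M.condOuterX P t ω) u))

/-- Isolates the error `η`, with a coefficient known once the arm is fixed, from a remainder
measurable before the draw. -/
theorem exponent_eq (u : EuclideanSpace ℝ (Fin d)) (t : ℕ) (ω : Ω) :
    M.exponent P R u t ω =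
      2 * inner ℝ u (M.centered P (M.arm t ω) t ω) * M.η (M.arm t ω) (M.user t ω) t ω +
        M.predictableExponent P R u (M.arm t ω) (M.user t ω) t ω := by
  have hX : M.X P t ω = M.centered P (M.arm t ω) t ω := rfl
  have hb : M.b (M.arm t ω) t ω = M.centered P (M.arm t ω) t ω + M.meanContext P t ω := by
    rw [centered, sub_add_cancel]
  rw [exponent, noise, inner_sub_right, inner_variation, inner_variation, inner_smul_right,
    obsReward, reward, predictableExponent, hX, hb, inner_add_left,
    real_inner_comm u (M.centered P (M.arm t ω) t ω)]
  ring

theorem IsSemiparametric.measurable_predictableExponent (hM : M.IsSemiparametric P R T) {t : ℕ}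
    (ht : t ∈ Finset.Icc 1 T) (u : EuclideanSpace ℝ (Fin d)) (i : Fin N) (j : Fin n) :
    Measurable[M.history t] (M.predictableExponent P R u i j t) := by
  have h1 : Measurable[M.history t] fun ω => inner ℝ u (M.centered P i t ω) :=
    (measurable_centered i t).const_inner
  have h2 : Measurable[M.history t] fun ω => inner ℝ (M.centered P i t ω) (M.μ j) :=
    (measurable_centered i t).inner_const
  have h3 : Measurable[M.history t] fun ω => inner ℝ (M.meanContext P t ω) (M.μ j) :=
    (measurable_meanContext t).inner_const
  have h4 : ∀ v, Measurable[M.history t] fun ω => inner ℝ u (matVec (M.condOuterX P t ω) v) :=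
    fun v => (@measurable_matVec Ω (M.history t) d _ (measurable_condOuterX t) (fun _ => v)
      measurable_const).const_inner
  exact (((h1.mul (h2.add (((hM.measurable_ν j t ht).add h3).const_mul 2))).sub (h4 _)).sub
    (((h1.pow_const 2).add (h4 u)).const_mul _))

/-- The rounds, from `s` on and before `t`, that serve the user of round `s`. -/
def roundsFrom (M : GraphBandit Ω d N n) (s t : ℕ) (ω : Ω) : Finset ℕ :=
  (Finset.Ico s t).filter fun τ => M.user τ ω = M.user s ω

theorem measurableSet_user_eq_history {s τ : ℕ} (hs : 1 ≤ s) (hsτ : s ≤ τ) :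
    MeasurableSet[M.history τ] {ω | M.user τ ω = M.user s ω} :=
  @measurableSet_eq_fun Ω (Fin n) (M.history τ) _ _ _ _ (M.measurable_user_history τ)
    ((M.measurable_user_history s).mono (M.history_mono hs hsτ) le_rfl)

theorem measurable_exponent_history (u : EuclideanSpace ℝ (Fin d)) {τ t : ℕ} (hτ : 1 ≤ τ)
    (hτt : τ < t) : Measurable[M.history t] (M.exponent P R u τ) :=
  (measurable_noise_history hτ hτt).const_inner.sub
    ((@measurable_matVec Ω (M.history t) d _ (measurable_variation_history hτ hτt) (fun _ => u)
      measurable_const).const_inner.const_mul _)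

variable [IsProbabilityMeasure P]

theorem IsSemiparametric.ae_sum_armLaw_mul_exp_le (hM : M.IsSemiparametric P R T) {t : ℕ}
    (ht : t ∈ Finset.Icc 1 T) (u : EuclideanSpace ℝ (Fin d)) :
    ∀ᵐ ω ∂P, ∀ j, ∑ i, M.armLaw P t i ω * (Real.exp (M.predictableExponent P R u i j t ω) *
      Real.exp ((2 * inner ℝ u (M.centered P i t ω)) ^ 2 * R ^ 2 / 2)) ≤ 1 := by
  filter_upwards [hM.ae_inner_condOuterX ht, hM.ae_sum_armLaw ht,
    ae_armLaw_nonneg (M := M) (P := P) t, hM.ae_norm_meanContext_le ht, hM.ae_meanContext ht]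
    with ω h1 h2 h3 h4 h5 j
  refine le_trans (le_of_eq ?_) (sum_mul_exp_le_one Finset.univ (p := fun i => M.armLaw P t i ω)
    (s := fun i => inner ℝ u (M.centered P i t ω))
    (m := fun i => inner ℝ (M.centered P i t ω) (M.μ j))
    (f := 2 * (M.ν j t ω + inner ℝ (M.meanContext P t ω) (M.μ j)))
    (κ := 2 * R ^ 2 + 8)
    (fun i _ => h3 i) h2 ?_ (h1 u (M.μ j)).symm
    (Cs := inner ℝ u (matVec (M.condOuterX P t ω) u)) ?_ ?_ ?_)
  -- With `s = ⟨u, b_i^c⟩`, the sub-Gaussian factor contributes `(2s)² R² / 2 = 2R² s²`, which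
  -- cancels that part of the penalty and leaves `8 s²`.
  · refine Finset.sum_congr rfl fun i _ => ?_
    rw [← Real.exp_add, predictableExponent]
    congr 2
    ring
  · have : ∑ i, M.armLaw P t i ω • M.centered P i t ω = 0 := by
      simp only [centered, smul_sub, Finset.sum_sub_distrib, ← Finset.sum_smul]
      rw [← h5, h2, one_smul, sub_self]
    have h6 := congrArg (fun v => inner ℝ u v) this
    simpa only [inner_sum, inner_smul_right, inner_zero_right] using h6
  · rw [h1]
    refine Finset.sum_congr rfl fun i _ => ?_
    rw [real_inner_comm u (M.centered P i t ω)]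
  · intro i _
    have hb : inner ℝ (M.centered P i t ω) (M.μ j) =
        inner ℝ (M.b i t ω) (M.μ j) - inner ℝ (M.meanContext P t ω) (M.μ j) := by
      rw [centered, inner_sub_left]
    have hi : ∀ v : EuclideanSpace ℝ (Fin d), ‖v‖ ≤ 1 → |inner ℝ v (M.μ j)| ≤ 1 := fun v hv =>
      (abs_real_inner_le_norm _ _).trans (mul_le_one₀ hv (norm_nonneg _) (hM.norm_μ_le j))
    have hb1 := abs_le.1 (hi _ (hM.norm_b_le i t ht ω))
    have hb2 := abs_le.1 (hi _ h4)
    have hν := abs_le.1 (hM.abs_ν_le j t ht ω)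
    -- The multiplier of `s` is `⟨b_i, μ_j⟩ + ⟨b̄, μ_j⟩ + 2 ν_j`, whence the bound `1 + 1 + 2 = 4`.
    rw [hb, abs_le]
    constructor <;> linarith
  · linarith [sq_nonneg R]

/-- One step of the exponential supermartingale. -/
theorem IsSemiparametric.lintegral_mul_exp_exponent_le (hM : M.IsSemiparametric P R T) {t : ℕ}
    (ht : t ∈ Finset.Icc 1 T) (u : EuclideanSpace ℝ (Fin d)) {H : Ω → ENNReal}
    (hH : Measurable[M.history t] H) :
    ∫⁻ ω, H ω * ENNReal.ofReal (Real.exp (M.exponent P R u t ω)) ∂P ≤ ∫⁻ ω, H ω ∂P := by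
  have hm := hM.history_le t ht
  set c : Fin N → Ω → ℝ := fun i ω => 2 * inner ℝ u (M.centered P i t ω) with hc
  have hcm : ∀ i, Measurable[M.history t] (c i) := fun i =>
    (measurable_centered i t).const_inner.const_mul 2
  set G : Fin N → Fin n → Ω → ENNReal := fun i j => (M.user t ⁻¹' {j}).indicator fun ω =>
    H ω * ENNReal.ofReal (Real.exp (M.predictableExponent P R u i j t ω)) with hG
  have hGm : ∀ i j, Measurable[M.history t] (G i j) := fun i j =>
    (hH.mul (hM.measurable_predictableExponent ht u i j).exp.ennreal_ofReal).indicator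
      (M.measurable_user_history t (measurableSet_singleton j))
  have hA : ∀ i, MeasurableSet (M.arm t ⁻¹' {i}) := fun i =>
    hM.measurable_arm t ht (measurableSet_singleton i)
  have hpm : ∀ i, Measurable[M.history t] fun ω => ENNReal.ofReal (M.armLaw P t i ω) := fun i =>
    (stronglyMeasurable_condExp.measurable : Measurable[M.history t] (M.armLaw P t i)).ennreal_ofReal
  have hGη : ∀ i j, Measurable fun ω =>
      G i j ω * ENNReal.ofReal (Real.exp (c i ω * M.η i j t ω)) := fun i j =>
    ((hGm i j).mono hm le_rfl).mul ((((hcm i).mono hm le_rfl).mul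
      (hM.measurable_η i j t ht)).exp.ennreal_ofReal)
  -- The hypotheses on `η` hold for a fixed arm and a fixed user, so the integral is split over both
  -- values. The user's indicator is already known and goes into `G`; only the arm's is random given
  -- the history.
  have hsplit : ∀ ω, H ω * ENNReal.ofReal (Real.exp (M.exponent P R u t ω)) =
      ∑ i, ∑ j, (M.arm t ⁻¹' {i}).indicator
        (fun ω => G i j ω * ENNReal.ofReal (Real.exp (c i ω * M.η i j t ω))) ω := by
    intro ω
    rw [Finset.sum_eq_single (M.arm t ω), Finset.sum_eq_single (M.user t ω)]
    · rw [exponent_eq, Real.exp_add, mul_comm (Real.exp _), ENNReal.ofReal_mul (Real.exp_pos _).le,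
        ← mul_assoc]
      simp [hG, hc]
    · intro j _ hj
      simp [hG, hj.symm]
    · simp
    · intro i _ hi
      simp [hi.symm]
    · simp
  calc ∫⁻ ω, H ω * ENNReal.ofReal (Real.exp (M.exponent P R u t ω)) ∂P
      = ∑ i, ∑ j, ∫⁻ ω in M.arm t ⁻¹' {i},
          G i j ω * ENNReal.ofReal (Real.exp (c i ω * M.η i j t ω)) ∂P := by
        rw [lintegral_congr hsplit, lintegral_finsetSum _ fun i _ =>
          Finset.measurable_fun_sum _ fun j _ => (hGη i j).indicator (hA i)]
        refine Finset.sum_congr rfl fun i _ => ?_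
        rw [lintegral_finsetSum _ fun j _ => (hGη i j).indicator (hA i)]
        exact Finset.sum_congr rfl fun j _ => lintegral_indicator (hA i) _
    _ = ∑ i, ∑ j, ∫⁻ ω, (ENNReal.ofReal (M.armLaw P t i ω) * G i j ω) *
          ENNReal.ofReal (Real.exp (c i ω * M.η i j t ω)) ∂P := by
        refine Finset.sum_congr rfl fun i _ => Finset.sum_congr rfl fun j _ => ?_
        rw [lintegral_indicator_mul_exp_eq hm (hA i) (hM.measurable_η i j t ht)
          (fun S hS => hM.condIndep_arm i j t ht i S hS) (hGm i j) (hcm i)]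
        exact lintegral_congr fun ω => (mul_assoc _ _ _).symm
    _ ≤ ∑ i, ∑ j, ∫⁻ ω, (ENNReal.ofReal (M.armLaw P t i ω) * G i j ω) *
          ENNReal.ofReal (Real.exp (c i ω ^ 2 * R ^ 2 / 2)) ∂P := by
        refine Finset.sum_le_sum fun i _ => Finset.sum_le_sum fun j _ => ?_
        exact lintegral_mul_exp_mul_le_of_condExp_le hm (hM.measurable_η i j t ht)
          (hM.subGaussian_η i j t ht) ((hpm i).mul (hGm i j)) (hcm i)
    _ = ∫⁻ ω, ∑ i, ∑ j, (ENNReal.ofReal (M.armLaw P t i ω) * G i j ω) *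
          ENNReal.ofReal (Real.exp (c i ω ^ 2 * R ^ 2 / 2)) ∂P := by
        have hmeas : ∀ i j, Measurable fun ω => (ENNReal.ofReal (M.armLaw P t i ω) * G i j ω) *
            ENNReal.ofReal (Real.exp (c i ω ^ 2 * R ^ 2 / 2)) := fun i j =>
          (((hpm i).mono hm le_rfl).mul ((hGm i j).mono hm le_rfl)).mul
            (((((hcm i).mono hm le_rfl).pow_const 2).mul_const _).div_const _).exp.ennreal_ofReal
        rw [lintegral_finsetSum _ fun i _ => Finset.measurable_fun_sum _ fun j _ => hmeas i j]
        refine Finset.sum_congr rfl fun i _ => ?_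
        rw [lintegral_finsetSum _ fun j _ => hmeas i j]
    _ ≤ ∫⁻ ω, H ω ∂P := by
        refine lintegral_mono_ae ?_
        filter_upwards [hM.ae_sum_armLaw_mul_exp_le ht u, ae_armLaw_nonneg (M := M) (P := P) t]
          with ω h1 h2
        calc _ = ∑ i, H ω * ENNReal.ofReal (M.armLaw P t i ω *
              (Real.exp (M.predictableExponent P R u i (M.user t ω) t ω) *
                Real.exp (c i ω ^ 2 * R ^ 2 / 2))) := by
              refine Finset.sum_congr rfl fun i _ => ?_
              rw [Finset.sum_eq_single (M.user t ω)]
              · rw [ENNReal.ofReal_mul (h2 i), ENNReal.ofReal_mul (Real.exp_pos _).le]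
                simp only [hG, Set.indicator, Set.mem_preimage, Set.mem_singleton_iff, if_true]
                ring
              · intro j _ hj
                simp [hG, hj.symm]
              · simp
          _ = H ω * ENNReal.ofReal (∑ i, M.armLaw P t i ω *
              (Real.exp (M.predictableExponent P R u i (M.user t ω) t ω) *
                Real.exp (c i ω ^ 2 * R ^ 2 / 2))) := by
              rw [← Finset.mul_sum, ENNReal.ofReal_sum_of_nonneg]
              exact fun i _ => mul_nonneg (h2 i) (by positivity)
          _ ≤ H ω * 1 := by
              gcongr
              exact ENNReal.ofReal_le_one.2 (h1 _)
          _ = H ω := mul_one _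

/-- The exponential supermartingale of the user of round `s`. -/
theorem IsSemiparametric.lintegral_exp_sum_exponent_le (hM : M.IsSemiparametric P R T)
    (u : EuclideanSpace ℝ (Fin d)) {s t : ℕ} (hs : 1 ≤ s) (hst : s ≤ t) (htT : t ≤ T) :
    ∫⁻ ω, ENNReal.ofReal (Real.exp (∑ τ ∈ M.roundsFrom s t ω, M.exponent P R u τ ω)) ∂P ≤ 1 := by
  classical
  have hind : ∀ t ω, ∑ τ ∈ M.roundsFrom s t ω, M.exponent P R u τ ω = ∑ τ ∈ Finset.Ico s t,
      ({ω | M.user τ ω = M.user s ω}.indicator (M.exponent P R u τ)) ω := by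
    intro t ω
    rw [roundsFrom, Finset.sum_filter]
    exact Finset.sum_congr rfl fun τ _ => by simp [Set.indicator]
  induction t, hst using Nat.le_induction with
  | base => simp [roundsFrom]
  | succ t hst ih =>
    have ht1 : 1 ≤ t := hs.trans hst
    have ht : t ∈ Finset.Icc 1 T := Finset.mem_Icc.2 ⟨ht1, (Nat.le_succ t).trans htT⟩
    refine le_trans ?_ (ih ((Nat.le_succ t).trans htT))
    set H : Ω → ENNReal := fun ω => ENNReal.ofReal
      (Real.exp (∑ τ ∈ M.roundsFrom s t ω, M.exponent P R u τ ω)) with hH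
    have hHm : Measurable[M.history t] H := by
      have : Measurable[M.history t] fun ω => ∑ τ ∈ M.roundsFrom s t ω, M.exponent P R u τ ω := by
        simp only [hind]
        refine Finset.measurable_fun_sum _ fun τ hτ => ?_
        have hτ' := Finset.mem_Ico.1 hτ
        have hτ1 : 1 ≤ τ := hs.trans hτ'.1
        exact (measurable_exponent_history u hτ1 hτ'.2).indicator
          (M.history_mono hτ1 hτ'.2.le _ (measurableSet_user_eq_history hs hτ'.1))
      exact this.exp.ennreal_ofReal
    set A : Set Ω := {ω | M.user t ω = M.user s ω} with hA
    have hAm : MeasurableSet[M.history t] A := measurableSet_user_eq_history hs hst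
    -- Whether round `t` serves the user of round `s` is known before the draw: on `A` one factor is
    -- gained, off `A` nothing changes.
    have hstep : ∀ ω, ENNReal.ofReal (Real.exp (∑ τ ∈ M.roundsFrom s (t + 1) ω,
        M.exponent P R u τ ω)) = A.indicator H ω *
          ENNReal.ofReal (Real.exp (M.exponent P R u t ω)) + Aᶜ.indicator H ω := by
      intro ω
      rw [hind, Finset.sum_Ico_succ_top hst, ← hind, Real.exp_add,
        ENNReal.ofReal_mul (Real.exp_pos _).le]
      by_cases hω : ω ∈ A
      · simp [hω, hH, ← hA]
      · simp [hω, hH, ← hA]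
    have hle := hM.history_le t ht
    calc _ = ∫⁻ ω, A.indicator H ω * ENNReal.ofReal (Real.exp (M.exponent P R u t ω)) ∂P +
          ∫⁻ ω, Aᶜ.indicator H ω ∂P := by
          rw [lintegral_congr hstep, lintegral_add_right _
            ((hHm.indicator hAm.compl).mono hle le_rfl)]
      _ ≤ ∫⁻ ω, A.indicator H ω ∂P + ∫⁻ ω, Aᶜ.indicator H ω ∂P := by
          exact add_le_add (hM.lintegral_mul_exp_exponent_le ht u (hHm.indicator hAm)) le_rfl
      _ = ∫⁻ ω, H ω ∂P := by
          rw [← lintegral_add_right _ ((hHm.indicator hAm.compl).mono hle le_rfl)]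
          exact lintegral_congr fun ω => Set.indicator_self_add_compl_apply A H ω

end GraphBandit

/-! ### Laplacian row sums and the numerical constants -/

theorem rwLaplacian_self {n : ℕ} (G : SimpleGraph (Fin n)) (j : Fin n) :
    rwLaplacian G j j = 1 := if_pos rfl

theorem sum_abs_rwLaplacian_le {n : ℕ} (G : SimpleGraph (Fin n)) (j : Fin n) :
    ∑ k ∈ Finset.univ.erase j, |rwLaplacian G j k| ≤ 1 := by
  classical
  calc ∑ k ∈ Finset.univ.erase j, |rwLaplacian G j k|
      = ∑ k ∈ Finset.univ.erase j, if G.Adj j k then 1 / (G.degree j : ℝ) else 0 := by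
        refine Finset.sum_congr rfl fun k hk => ?_
        rw [rwLaplacian, if_neg (Finset.ne_of_mem_erase hk).symm]
        split_ifs
        · rw [abs_div, abs_neg, abs_one, Nat.abs_cast]
        · exact abs_zero
    _ ≤ ∑ k, if G.Adj j k then 1 / (G.degree j : ℝ) else 0 :=
        Finset.sum_le_sum_of_subset_of_nonneg (Finset.erase_subset _ _) fun k _ _ => by
          split_ifs <;> positivity
    _ = G.degree j * (1 / (G.degree j : ℝ)) := by
        rw [← Finset.sum_filter, Finset.sum_const, nsmul_eq_mul, ← G.card_neighborFinset_eq_degree,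
          G.neighborFinset_eq_filter]
    _ ≤ 1 := by
        rw [mul_one_div]
        -- For an isolated vertex the quotient is `0 / 0 = 0`, which explains the inequality.
        exact div_self_le_one _

/-- The confidence width dominates the bound of the mixture method with `2 R² + 8` as proxy. -/
theorem four_mul_log_add_le_sq {d t : ℕ} (hd : 1 ≤ d) (ht : 1 ≤ t) {R lam δ : ℝ} (hR : 0 ≤ R)
    (hlam : 0 < lam) (hδ : δ ∈ Set.Ioo (0 : ℝ) 1) :
    4 * (2 * R ^ 2 + 8) * (Real.log (1 / (δ / (t : ℝ) ^ 3)) +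
      d / 2 * Real.log ((lam / 4 + 8 * t) / (lam / 4))) ≤
    ((2 * R + 4) * Real.sqrt (2 * d * Real.log (24 * (t : ℝ) ^ 4 / δ * (1 + 1 / lam)))) ^ 2 := by
  obtain ⟨hδ0, hδ1⟩ := hδ
  have ht' : (1 : ℝ) ≤ t := by exact_mod_cast ht
  have hd' : (1 : ℝ) ≤ d := by exact_mod_cast hd
  set w : ℝ := 1 + 1 / lam with hw
  have hw1 : 1 ≤ w := by rw [hw]; linarith [one_div_pos.2 hlam]
  have hL : Real.log (24 * (t : ℝ) ^ 4 / δ * w) =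
      Real.log (1 / (δ / (t : ℝ) ^ 3)) + Real.log (24 * t * w) := by
    rw [← Real.log_mul (by positivity) (by positivity)]
    congr 1
    field_simp
  have h1 : 0 ≤ Real.log (1 / (δ / (t : ℝ) ^ 3)) := by
    refine Real.log_nonneg ?_
    rw [one_div_div, le_div_iff₀ hδ0]
    nlinarith [one_le_pow₀ ht' (n := 3)]
  have h2 : 0 ≤ Real.log (24 * t * w) := Real.log_nonneg (by nlinarith)
  have h3 : Real.log ((lam / 4 + 8 * t) / (lam / 4)) ≤ 2 * Real.log (24 * t * w) := by
    have hlog : 2 * Real.log (24 * t * w) = Real.log ((24 * t * w) ^ 2) := by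
      rw [Real.log_pow, Nat.cast_two]
    rw [hlog]
    refine Real.log_le_log (by positivity) ?_
    -- The ratio `1 + 32 t / λ` is below `(24 t w)²`; the square cancels the factor `1/2` in front
    -- of `d`.
    have : (lam / 4 + 8 * t) / (lam / 4) = 1 + 32 * t * (w - 1) := by
      rw [hw]; field_simp; ring
    rw [this]
    have : 1 ≤ t * w := by nlinarith
    nlinarith
  rw [mul_pow, Real.sq_sqrt (by rw [hL]; positivity), hL]
  -- Here `d ≥ 1` is needed, since `log (1/p)` carries no factor `d`.
  have h4 : Real.log (1 / (δ / (t : ℝ) ^ 3)) +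
      d / 2 * Real.log ((lam / 4 + 8 * t) / (lam / 4)) ≤
      d * (Real.log (1 / (δ / (t : ℝ) ^ 3)) + Real.log (24 * t * w)) := by
    nlinarith
  calc _ ≤ 4 * (2 * R ^ 2 + 8) *
        (d * (Real.log (1 / (δ / (t : ℝ) ^ 3)) + Real.log (24 * t * w))) := by gcongr
    _ ≤ (2 * R + 4) ^ 2 *
        (2 * (d * (Real.log (1 / (δ / (t : ℝ) ^ 3)) + Real.log (24 * t * w)))) := by
        have : 0 ≤ d * (Real.log (1 / (δ / (t : ℝ) ^ 3)) + Real.log (24 * t * w)) := by positivity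
        nlinarith [mul_nonneg hR this]
    _ = _ := by ring

/-! ### From control of the noise to the confidence bound -/

namespace GraphBandit

variable {Ω : Type*} {d N n : ℕ} {mΩ : MeasurableSpace Ω} {P : Measure Ω}
  {M : GraphBandit Ω d N n} {R : ℝ} {T : ℕ}

theorem inner_sum_variation (s : Finset ℕ) (ω : Ω) (u : EuclideanSpace ℝ (Fin d)) :
    inner ℝ u (matVec (∑ τ ∈ s, M.variation P τ ω) u) =
      ∑ τ ∈ s, inner ℝ u (matVec (M.variation P τ ω) u) := by
  rw [sum_matVec, inner_sum]

theorem isSymm_sum_variation (s : Finset ℕ) (ω : Ω) :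
    (∑ τ ∈ s, M.variation P τ ω).IsSymm := by
  rw [Matrix.IsSymm, Matrix.transpose_sum]
  exact Finset.sum_congr rfl fun τ _ => isSymm_variation τ ω

theorem B_eq (lam : ℝ) (k : Fin n) (t : ℕ) (ω : Ω) :
    M.B P lam k t ω = ∑ τ ∈ M.served k (t - 1) ω, M.variation P τ ω +
      lam • (1 : Matrix (Fin d) (Fin d) ℝ) := by
  simp only [B, variation, Finset.sum_add_distrib, rwLaplacian_self, mul_one]

/-- Holds round by round by the definition of `noise`; the `λ` part of `B_k` accounts for the ridge
bias. -/
theorem score_eq (lam : ℝ) (k : Fin n) (t : ℕ) (ω : Ω) :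
    ∑ τ ∈ M.served k (t - 1) ω, (2 * M.reward (M.arm τ ω) k τ ω) • M.X P τ ω =
      matVec (M.B P lam k t ω) (M.μ k) - lam • M.μ k +
        ∑ τ ∈ M.served k (t - 1) ω, M.noise P τ ω := by
  have : ∀ τ ∈ M.served k (t - 1) ω, (2 * M.reward (M.arm τ ω) k τ ω) • M.X P τ ω =
      matVec (M.variation P τ ω) (M.μ k) + M.noise P τ ω := by
    intro τ hτ
    have hk : M.user τ ω = k := (Finset.mem_filter.1 hτ).2
    rw [noise, obsReward, hk]
    abel
  rw [Finset.sum_congr rfl this, Finset.sum_add_distrib, B_eq, add_matVec, smul_matVec, one_matVec,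
    add_sub_cancel_right, sum_matVec]

/-- Take `s` to be the first round serving `k`. This trades a union over users for one over rounds,
and keeps `n` out of the confidence width. -/
theorem served_eq_empty_or_roundsFrom (k : Fin n) (t : ℕ) (ω : Ω) :
    M.served k (t - 1) ω = ∅ ∨
      ∃ s ∈ Finset.Ico 1 t, M.served k (t - 1) ω = M.roundsFrom s t ω := by
  rcases (M.served k (t - 1) ω).eq_empty_or_nonempty with h | h
  · exact Or.inl h
  right
  have hmem : ∀ τ, τ ∈ M.served k (t - 1) ω ↔ (1 ≤ τ ∧ τ < t) ∧ M.user τ ω = k := by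
    intro τ
    simp only [served, Finset.mem_filter, Finset.mem_Icc]
    omega
  have hs := (M.served k (t - 1) ω).min'_mem h
  have hmin := fun τ hτ => (M.served k (t - 1) ω).min'_le τ hτ
  set s := (M.served k (t - 1) ω).min' h
  have hs' := (hmem s).1 hs
  refine ⟨s, Finset.mem_Ico.2 hs'.1, ?_⟩
  ext τ
  rw [roundsFrom, Finset.mem_filter, Finset.mem_Ico, hs'.2]
  constructor
  · intro h
    exact ⟨⟨hmin τ h, ((hmem τ).1 h).1.2⟩, ((hmem τ).1 h).2⟩
  · rintro ⟨⟨h1, h2⟩, h3⟩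
    exact (hmem τ).2 ⟨⟨hs'.1.1.trans h1, h2⟩, h3⟩

theorem measurable_sum_roundsFrom {s t : ℕ} (hs : 1 ≤ s) {E : Type*} [AddCommMonoid E]
    [MeasurableSpace E] [MeasurableAdd₂ E] {f : ℕ → Ω → E}
    (hf : ∀ τ ∈ Finset.Ico s t, Measurable[M.history t] (f τ)) :
    Measurable[M.history t] fun ω => ∑ τ ∈ M.roundsFrom s t ω, f τ ω := by
  classical
  have : (fun ω => ∑ τ ∈ M.roundsFrom s t ω, f τ ω) = fun ω => ∑ τ ∈ Finset.Ico s t,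
      ({ω | M.user τ ω = M.user s ω}.indicator (f τ)) ω := by
    ext ω
    rw [roundsFrom, Finset.sum_filter]
    exact Finset.sum_congr rfl fun τ _ => by simp [Set.indicator]
  rw [this]
  refine Finset.measurable_fun_sum _ fun τ hτ => (hf τ hτ).indicator ?_
  have hτ' := Finset.mem_Ico.1 hτ
  exact M.history_mono (hs.trans hτ'.1) hτ'.2.le _ (measurableSet_user_eq_history hs hτ'.1)

/-- The confidence bound holds as soon as the noise of every user is under control. -/
theorem abs_inner_muHat_sub_le {t : ℕ} {lam K : ℝ} (hlam : 0 < lam)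
    (hK : 0 ≤ K) (hμ : ∀ j, ‖M.μ j‖ ≤ 1) {ω : Ω}
    (hvar : ∀ τ ∈ Finset.Ico 1 t, ∀ u, 0 ≤ inner ℝ u (matVec (M.variation P τ ω) u))
    (hnoise : ∀ s ∈ Finset.Ico 1 t, ∀ v,
      2 * inner ℝ v (∑ τ ∈ M.roundsFrom s t ω, M.noise P τ ω) -
        inner ℝ v (matVec (∑ τ ∈ M.roundsFrom s t ω, M.variation P τ ω) v) - lam / 4 * ‖v‖ ^ 2 ≤
        K ^ 2) (j : Fin n) (x : EuclideanSpace ℝ (Fin d)) :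
    |inner ℝ x (M.muHat P lam j t ω - M.μ j)| ≤ weightedNorm (M.Gam P lam j t ω)⁻¹ x *
      (2 * K + Real.sqrt (2 * lam) * (1 + ‖M.Delta j‖)) := by
  have hform : ∀ k v, inner ℝ v (matVec (M.B P lam k t ω) v) =
      inner ℝ v (matVec (∑ τ ∈ M.served k (t - 1) ω, M.variation P τ ω) v) + lam * ‖v‖ ^ 2 := by
    intro k v
    rw [B_eq, add_matVec, smul_matVec, one_matVec, inner_add_right, inner_smul_right,
      real_inner_self_eq_norm_sq]
  have hΔ : M.Delta j = M.μ j + ∑ k ∈ Finset.univ.erase j, rwLaplacian M.graph j k • M.μ k := by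
    rw [Delta, ← Finset.add_sum_erase _ _ (Finset.mem_univ j), rwLaplacian_self, one_smul]
  rw [hΔ]
  refine abs_inner_adjustedEstimator_sub_le (Finset.univ.erase j)
    (B := fun k => M.B P lam k t ω) (l := rwLaplacian M.graph j) (μ := M.μ)
    (S := fun k => ∑ τ ∈ M.served k (t - 1) ω,
      (2 * M.reward (M.arm τ ω) k τ ω) • M.X P τ ω)
    (Z := fun k => ∑ τ ∈ M.served k (t - 1) ω, M.noise P τ ω)
    (fun k => ?_) hlam (fun k v => ?_) (sum_abs_rwLaplacian_le _ j) hμ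
    (fun k => score_eq lam k t ω) hK (fun k v => ?_) x
  · rw [B_eq]
    exact (isSymm_sum_variation _ ω).add (Matrix.isSymm_one.smul _)
  · rw [hform, inner_sum_variation]
    have : 0 ≤ ∑ τ ∈ M.served k (t - 1) ω, inner ℝ v (matVec (M.variation P τ ω) v) := by
      refine Finset.sum_nonneg fun τ hτ => hvar τ ?_ v
      have := Finset.mem_Icc.1 (Finset.mem_filter.1 hτ).1
      exact Finset.mem_Ico.2 (by omega)
    linarith
  · rw [hform]
    rcases M.served_eq_empty_or_roundsFrom k t ω with h | ⟨s, hs, h⟩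
    -- A user never served has no noise, and `-λ + (3/4) λ` is negative.
    · rw [h, inner_sum_variation]
      simp only [Finset.sum_empty, inner_zero_right]
      nlinarith [sq_nonneg K, mul_nonneg hlam.le (sq_nonneg ‖v‖)]
    · rw [h]
      linarith [hnoise s hs v]

variable [IsProbabilityMeasure P]

/-- Self-normalized tail bound for the noise of the user of round `s`. -/
theorem IsSemiparametric.measure_noise_roundsFrom_le (hM : M.IsSemiparametric P R T) {s t : ℕ}
    (hs : 1 ≤ s) (hst : s ≤ t) (htT : t ≤ T) {ρ : ℝ} (hρ : 0 < ρ) {p : ℝ} (hp : 0 < p) :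
    P {ω | ∃ v, 4 * (2 * R ^ 2 + 8) * (Real.log (1 / p) +
        d / 2 * Real.log ((ρ + 8 * t) / ρ)) <
      2 * inner ℝ v (∑ τ ∈ M.roundsFrom s t ω, M.noise P τ ω) -
        inner ℝ v (matVec (∑ τ ∈ M.roundsFrom s t ω, M.variation P τ ω) v) - ρ * ‖v‖ ^ 2} ≤
      ENNReal.ofReal p := by
  have ht : t ∈ Finset.Icc 1 T := Finset.mem_Icc.2 ⟨hs.trans hst, htT⟩
  have hle := hM.history_le t ht
  refine measure_exists_lt_le_of_lintegral_exp_le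
    (Z := fun ω => ∑ τ ∈ M.roundsFrom s t ω, M.noise P τ ω)
    (W := fun ω => ∑ τ ∈ M.roundsFrom s t ω, M.variation P τ ω)
    ?_ (fun p q => ?_) (fun ω => isSymm_sum_variation _ ω) (by positivity) ?_ (by positivity)
    (fun u => ?_) hρ hp
  · exact (measurable_sum_roundsFrom hs fun τ hτ => measurable_noise_history
      (hs.trans (Finset.mem_Ico.1 hτ).1) (Finset.mem_Ico.1 hτ).2).mono hle le_rfl
  · simp only [Matrix.sum_apply]
    exact (measurable_sum_roundsFrom (f := fun τ ω => M.variation P τ ω p q) hs fun τ hτ =>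
      measurable_variation_history (hs.trans (Finset.mem_Ico.1 hτ).1)
        (Finset.mem_Ico.1 hτ).2 p q).mono hle le_rfl
  · have hall : ∀ᵐ ω ∂P, ∀ τ ∈ Finset.Icc 1 T, ∀ u,
        inner ℝ u (matVec (M.variation P τ ω) u) ≤ 8 * ‖u‖ ^ 2 :=
      (ae_ball_iff (Finset.countable_toSet _)).2 fun τ hτ =>
        (hM.ae_variation_bounds hτ).mono fun ω h u => (h u).2
    filter_upwards [hall] with ω hω u
    rw [inner_sum_variation]
    calc ∑ τ ∈ M.roundsFrom s t ω, inner ℝ u (matVec (M.variation P τ ω) u)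
        ≤ ∑ τ ∈ M.roundsFrom s t ω, 8 * ‖u‖ ^ 2 := by
          refine Finset.sum_le_sum fun τ hτ => hω τ ?_ u
          have := Finset.mem_Ico.1 (Finset.mem_filter.1 hτ).1
          exact Finset.mem_Icc.2 ⟨hs.trans this.1, this.2.le.trans htT⟩
      _ = (M.roundsFrom s t ω).card * (8 * ‖u‖ ^ 2) := by rw [Finset.sum_const, nsmul_eq_mul]
      _ ≤ t * (8 * ‖u‖ ^ 2) := by
          gcongr
          refine (Finset.card_filter_le _ _).trans ?_
          rw [Nat.card_Ico]
          exact Nat.sub_le _ _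
      _ = 8 * t * ‖u‖ ^ 2 := by ring
  · refine le_trans (le_of_eq (lintegral_congr fun ω => ?_))
      (hM.lintegral_exp_sum_exponent_le u hs hst htT)
    simp only [exponent, Finset.sum_sub_distrib, inner_sum, inner_sum_variation, Finset.mul_sum]

end GraphBandit

theorem theorem2 {Ω : Type*} [MeasurableSpace Ω] (P : Measure Ω) [IsProbabilityMeasure P]
    {d N n : ℕ} (M : GraphBandit Ω d N n) (T : ℕ) (R : ℝ) (hR : 0 ≤ R)
    (hM : M.IsSemiparametric P R T) (lam : ℝ) (hlam : 0 < lam)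
    (δ : ℝ) (hδ : δ ∈ Set.Ioo (0 : ℝ) 1) (t : ℕ) (ht : 1 ≤ t) (htT : t ≤ T) :
    1 - δ / (t : ℝ) ^ 2 ≤
      P.real {ω | ∀ i : Fin N,
        |inner ℝ (M.centered P i t ω)
            (M.muHat P lam (M.user t ω) t ω - M.μ (M.user t ω))| ≤
          weightedNorm (M.Gam P lam (M.user t ω) t ω)⁻¹ (M.centered P i t ω) *
            M.alpha R lam δ (M.user t ω) t} := by
  have hδ0 := hδ.1
  have ht0 : (0 : ℝ) < t := by exact_mod_cast ht
  have halpha : ∀ j, M.alpha R lam δ j t = 2 * ((2 * R + 6) * Real.sqrt (2 * d *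
      Real.log (24 * (t : ℝ) ^ 4 / δ * (1 + 1 / lam)))) +
        Real.sqrt (2 * lam) * (1 + ‖M.Delta j‖) := fun j => by
    rw [GraphBandit.alpha]; ring
  set good : Set Ω := _ with hgood
  change _ ≤ P.real good
  -- In dimension `0` the logarithmic comparison fails, but every inner product vanishes.
  rcases Nat.eq_zero_or_pos d with rfl | hd
  · have : good = Set.univ := by
      refine Set.eq_univ_of_forall fun ω i => ?_
      rw [Subsingleton.elim (M.centered P i t ω) 0, inner_zero_left, abs_zero, halpha]
      exact mul_nonneg (weightedNorm_nonneg _ _) (by positivity)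
    rw [this, probReal_univ]
    linarith [div_nonneg hδ0.le (sq_nonneg (t : ℝ))]
  set K : ℝ := (2 * R + 4) * Real.sqrt (2 * d *
    Real.log (24 * (t : ℝ) ^ 4 / δ * (1 + 1 / lam))) with hK
  have hK0 : 0 ≤ K := by positivity
  set bad : ℕ → Set Ω := fun s => {ω | ∃ v, 4 * (2 * R ^ 2 + 8) *
    (Real.log (1 / (δ / (t : ℝ) ^ 3)) + d / 2 * Real.log ((lam / 4 + 8 * t) / (lam / 4))) <
      2 * inner ℝ v (∑ τ ∈ M.roundsFrom s t ω, M.noise P τ ω) -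
        inner ℝ v (matVec (∑ τ ∈ M.roundsFrom s t ω, M.variation P τ ω) v) -
          lam / 4 * ‖v‖ ^ 2} with hbad
  have hbadP : ∀ s ∈ Finset.Ico 1 t, P.real (bad s) ≤ δ / (t : ℝ) ^ 3 := fun s hs =>
    ENNReal.toReal_le_of_le_ofReal (by positivity)
      (hM.measure_noise_roundsFrom_le (Finset.mem_Ico.1 hs).1 (Finset.mem_Ico.1 hs).2.le htT
        (by positivity) (by positivity))
  have hvar : ∀ᵐ ω ∂P, ∀ τ ∈ Finset.Ico 1 t, ∀ u,
      0 ≤ inner ℝ u (matVec (M.variation P τ ω) u) := by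
    refine (ae_ball_iff (Finset.countable_toSet _)).2 fun τ hτ => ?_
    have := Finset.mem_Ico.1 hτ
    exact (hM.ae_variation_bounds (Finset.mem_Icc.2 ⟨this.1, this.2.le.trans htT⟩)).mono
      fun ω h u => (h u).1
  have hcover : goodᶜ ≤ᵐ[P] ⋃ s ∈ Finset.Ico 1 t, bad s := by
    filter_upwards [hvar] with ω hω
    refine not_imp_comm.1 fun hnot => ?_
    have hnot' : ∀ s ∈ Finset.Ico 1 t, ω ∉ bad s := fun s hs hmem =>
      hnot (Set.mem_biUnion hs hmem)
    intro i
    refine (GraphBandit.abs_inner_muHat_sub_le hlam hK0 hM.norm_μ_le hω (fun s hs v => ?_)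
      (M.user t ω) (M.centered P i t ω)).trans ?_
    · have h := hnot' s hs
      rw [hbad, Set.mem_ofPred_eq, not_exists] at h
      exact (not_lt.1 (h v)).trans (four_mul_log_add_le_sq hd ht hR hlam hδ)
    -- The noise bound gives `2R + 4`; the stated width has room up to `2R + 6`.
    · refine mul_le_mul_of_nonneg_left ?_ (weightedNorm_nonneg _ _)
      rw [halpha, hK]
      gcongr
      norm_num
  have hcompl : P.real goodᶜ ≤ δ / (t : ℝ) ^ 2 := by
    calc P.real goodᶜ ≤ P.real (⋃ s ∈ Finset.Ico 1 t, bad s) :=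
          ENNReal.toReal_mono (measure_ne_top _ _) (measure_mono_ae hcover)
      _ ≤ ∑ s ∈ Finset.Ico 1 t, P.real (bad s) := measureReal_biUnion_finset_le _ _
      _ ≤ ∑ s ∈ Finset.Ico 1 t, δ / (t : ℝ) ^ 3 := Finset.sum_le_sum hbadP
      _ = (t - 1 : ℕ) * (δ / (t : ℝ) ^ 3) := by
          rw [Finset.sum_const, Nat.card_Ico, nsmul_eq_mul]
      _ ≤ t * (δ / (t : ℝ) ^ 3) := by
          gcongr
          exact Nat.sub_le _ _
      _ = δ / (t : ℝ) ^ 2 := by field_simp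
  -- Subadditivity alone is used, so the good event need not be shown measurable.
  have hone : 1 ≤ P.real good + P.real goodᶜ := by
    rw [← probReal_univ (μ := P), ← Set.union_compl_self good]
    exact measureReal_union_le _ _
  linarith
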